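/- For a simplicial set $Y$ let $\mathrm{Ex}\,Y$ be the simplicial set with $(\mathrm{Ex}\,Y)_n=\mathsf{sSet}(\mathrm{sd}\,\Delta^n,Y)$, where $\mathrm{sd}\,\Delta^n$ is the nerve of the poset of non-empty subsets of $\{0,\dots,n\}$, and let $j_Y\colon Y\to \mathrm{Ex}\,Y$ be the natural map sending $\sigma\colon\Delta^n\to Y$ to its composite with the last-vertex map $\mathrm{sd}\,\Delta^n\to\Delta^n$, $S\mapsto\max S$. Let $\mathrm{Ex}^\infty Y$ be the colimit of the sequence $$Y\xrightarrow{\,j_Y\,}\mathrm{Ex}\,Y\xrightarrow{\,j_{\mathrm{Ex}\,Y}\,}\mathrm{Ex}(\mathrm{Ex}\,Y)\to\cdots .$$ A monomorphism $m\colon A\hookrightarrow B$ of simplicial sets is a strong anodyne extension if there are an ordinal $\kappa$ and an increasing family $(A^\alpha)_{\alpha\le\kappa}$ of subcomplexes of $B$ such that $A^0=A$ (that is, the image of $m$), $A^\kappa=\bigcup_{\alpha<\kappa}A^\alpha=B$, $A^\lambda=\bigcup_{\alpha<\lambda}A^\alpha$ for every non-zero limit ordinal $\lambda<\kappa$, and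 for every $\alpha<\kappa$ the inclusion $A^\alpha\hookrightarrow A^{\alpha+1}$ is a pushout of a coproduct of horn inclusions $\Lambda^n_k\hookrightarrow\Delta^n$ ($n\ge1$, $0\le k\le n$). A map $f$ of simplicial sets is a weak homotopy equivalence if $\mathrm{Ex}^\infty f$ is a simplicial homotopy equivalence. Corollary. For every simplicial set $X$, the canonical map $j\colon X\to\mathrm{Ex}^\infty X$ into the colimit is a strong anodyne extension. In particular, it is a weak homotopy equivalence. -/

import Mathlib

open CategoryTheory Limits Simplicial Opposite MonoidalCategory

universe u

noncomputable section

namespace ExInfinity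

/-! ### Strong anodyne extensions -/

/-- An anodyne presentation of a map `m : A ⟶ B` (meant for monomorphisms): an ordinal `κ` together
with an increasing family of subcomplexes `stage α` of `B`, for `α ≤ κ`, which starts at the image
of `A`, reaches `B` at `κ`, is continuous, and each of whose steps is a pushout of a coproduct of
horn inclusions `Λ[n, i] ⟶ Δ[n]`, `n ≥ 1`. Only the values `stage α` for `α ≤ κ` matter. -/
structure AnodynePresentation {A B : SSet.{u}} (m : A ⟶ B) where
  /-- the length of the presentation -/
  κ : Ordinal.{u}
  /-- the stages of the presentation -/
  stage : Ordinal.{u} → B.Subcomplex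
  mono : ∀ ⦃α β : Ordinal.{u}⦄, α ≤ β → β ≤ κ → stage α ≤ stage β
  stage_zero : stage 0 = SSet.Subcomplex.range m
  stage_top : stage κ = ⊤
  iSup_lt_top : ⨆ α : Set.Iio κ, stage α = ⊤
  iSup_lt_limit : ∀ l : Ordinal.{u}, l < κ → Order.IsSuccLimit l →
    ⨆ α : Set.Iio l, stage α = stage l
  attach : ∀ (α : Ordinal.{u}) (h : α < κ),
    (MorphismProperty.coproducts.{u} SSet.modelCategoryQuillen.J.{u}).pushouts
      (SSet.Subcomplex.homOfLE (mono (Order.le_succ α) (Order.succ_le_of_lt h)))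

/-- A strong anodyne extension is a monomorphism of simplicial sets which admits an anodyne
presentation. -/
def IsStrongAnodyne {A B : SSet.{u}} (m : A ⟶ B) : Prop :=
  Mono m ∧ Nonempty (AnodynePresentation m)

/-! ### The last-vertex map and the map `X ⟶ Ex X` -/

/-- The monotone map which sends a nonempty subset of `{0, ..., n}` to its greatest element. -/
def lastVertexHom (n : ℕ) :
    PartialOrder.NonemptyFiniteChains (ULift.{u} (Fin (n + 1))) →o Fin (n + 1) where
  toFun s := (s.finset.max' s.nonempty).down
  monotone' s _ h := Finset.max'_subset s.nonempty h

theorem lastVertexHom_map {n m : ℕ} (g : ULift.{u} (Fin (n + 1)) →o ULift.{u} (Fin (m + 1)))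
    (s : PartialOrder.NonemptyFiniteChains (ULift.{u} (Fin (n + 1)))) :
    lastVertexHom m (s.map g) = (g (ULift.up (lastVertexHom n s))).down := by
  apply le_antisymm
  · obtain ⟨x, hx, hxy⟩ := (PartialOrder.NonemptyFiniteChains.mem_map_iff s g _).1
      (Finset.max'_mem (s.map g).finset (s.map g).nonempty)
    change ULift.down (Finset.max' _ _) ≤ _
    rw [← hxy]
    exact g.monotone (Finset.le_max' s.finset x hx)
  · exact Finset.le_max' (s.map g).finset (g (ULift.up (lastVertexHom n s)))
      ((PartialOrder.NonemptyFiniteChains.mem_map_iff s g _).2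
        ⟨_, Finset.max'_mem _ s.nonempty, rfl⟩)

/-- The last-vertex maps `sd Δ[n] ⟶ Δ[n]`, as a natural transformation. -/
def lastVertex : SimplexCategory.sd.{u} ⟶ SSet.stdSimplex.{u} where
  app n :=
    { app := fun k => ↾fun (s : ComposableArrows _ k.unop.len) =>
        SSet.stdSimplex.objMk
          { toFun := fun i => lastVertexHom.{u} n.len (s.obj i)
            monotone' := fun _ _ h => (lastVertexHom.{u} n.len).monotone (s.map (homOfLE h)).le }
      naturality := fun _ _ _ => rfl }
  naturality := fun n m f => by
    ext k s
    refine SSet.stdSimplex.objEquiv.injective ?_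
    ext i : 3
    exact lastVertexHom_map (SimplexCategory.toPartOrd.{u}.map f).hom _

/-- The natural map `X ⟶ Ex X`, which sends an `n`-simplex `x : Δ[n] ⟶ X` to the composite of
the last-vertex map `sd Δ[n] ⟶ Δ[n]` with `x`. -/
def toEx : 𝟭 SSet.{u} ⟶ SSet.ex.{u} where
  app X :=
    { app := fun k => ↾fun x => ULift.up (lastVertex.app k.unop ≫ SSet.yonedaEquiv.symm x)
      naturality := fun k l f => by
        ext x
        refine ULift.ext _ _ ?_
        change lastVertex.app l.unop ≫ SSet.yonedaEquiv.symm (X.map f x) =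
          SimplexCategory.sd.map f.unop ≫ lastVertex.app k.unop ≫ SSet.yonedaEquiv.symm x
        rw [lastVertex.naturality_assoc, SSet.yonedaEquiv_symm_naturality_left]
        rfl }
  naturality := fun X Y f => by
    ext k x
    refine ULift.ext _ _ ?_
    change lastVertex.app k.unop ≫ SSet.yonedaEquiv.symm (f.app k x) =
      (lastVertex.app k.unop ≫ SSet.yonedaEquiv.symm x) ≫ f
    rw [Category.assoc, SSet.yonedaEquiv_symm_comp]

/-! ### The functor `Ex^∞` -/

/-- The iterates `Ex^n` of the functor `Ex`. -/
def exIter (n : ℕ) : SSet.{u} ⥤ SSet.{u} :=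
  match n with
  | 0 => (𝟭 SSet.{u})
  | n + 1 => exIter n ⋙ SSet.ex

/-- The transition maps `Ex^n X ⟶ Ex (Ex^n X)`. -/
def exIterSucc (n : ℕ) : exIter.{u} n ⟶ exIter.{u} (n + 1) :=
  Functor.whiskerLeft (exIter n) toEx

/-- The functor which sends `X` to the sequence `X ⟶ Ex X ⟶ Ex (Ex X) ⟶ ⋯`. -/
def exSequence : SSet.{u} ⥤ ℕ ⥤ SSet.{u} :=
  (Functor.ofSequence exIterSucc.{u}).flip

/-- The functor `Ex^∞`, the colimit of the sequence `X ⟶ Ex X ⟶ Ex (Ex X) ⟶ ⋯`. -/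
def exInfty : SSet.{u} ⥤ SSet.{u} :=
  exSequence ⋙ colim

/-- The canonical map from `X` into the colimit `Ex^∞ X`. -/
def toExInfty (X : SSet.{u}) : X ⟶ exInfty.obj X :=
  colimit.ι (exSequence.obj X) 0

/-! ### Weak homotopy equivalences -/

/-- A map `f : X ⟶ Y` of simplicial sets is a simplicial homotopy equivalence if there is
`g : Y ⟶ X` such that both composites are homotopic to the identity through maps
`X ⊗ Δ[1] ⟶ X` and `Y ⊗ Δ[1] ⟶ Y`. -/
def IsSimplicialHomotopyEquiv {X Y : SSet.{u}} (f : X ⟶ Y) : Prop :=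
  ∃ g : Y ⟶ X, Nonempty (SSet.Homotopy (f ≫ g) (𝟙 X)) ∧ Nonempty (SSet.Homotopy (g ≫ f) (𝟙 Y))

/-- A map `f` is a weak homotopy equivalence if `Ex^∞ f` is a simplicial homotopy equivalence. -/
def IsWeakHomotopyEquiv {X Y : SSet.{u}} (f : X ⟶ Y) : Prop :=
  IsSimplicialHomotopyEquiv (exInfty.map f)

end ExInfinity

end

noncomputable section

namespace ExInfinity

/-! The inclusion of `X` into `Ex X` is treated by pairing off the nondegenerate simplices of `Ex X`
outside `X`, each pair being a simplex and one of its codimension-one faces. An `n`-simplex is a map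
`y : sd Δ[n] ⟶ X`, and it lies in `X` exactly when it is unchanged by replacing each subset `S` with
`{0, ..., max S}`. The operations `saturate k n` interpolate between this replacement (`k = 0`) and
the identity (`k > n`), so every other simplex has a level: the unique `k` for which it is `(k +
1)`-saturated but not `k`-saturated. At that level `extend k y` has `y` as its face opposite to `k +
1`. Pairing `y` with `extend k y`, for those `y` which are not collapsible at their level, gives a
proper pairing, and the level is a weak rank function for it. Hence `X ⟶ Ex X` is built in `ω`
steps, each a pushout of a coproduct of horns, and concatenating these filtrations over all stages
presents `X ⟶ Ex^∞ X` in length `ω * ω`.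

For the weak equivalence, every horn in `Ex Y` extends to a simplex after passing to `Ex (Ex Y)`
(`exists_extension_of_horn`), so `Ex^∞ X` is a Kan complex. Maps into a Kan complex that agree on
the source of an anodyne monomorphism are homotopic (`exists_homotopy_of_anodyneExtensions`).
Therefore a retraction of the canonical map out of `Ex^∞ X` is a homotopy inverse of `Ex^∞` applied
to `X ⟶ Ex^∞ X`. -/

/-- The partially ordered type of nonempty subsets of `{0, ..., n}`. -/
abbrev Faces (n : ℕ) : Type u :=
  PartialOrder.NonemptyFiniteChains (ULift.{u} (Fin (n + 1)))

/-! ### Monotone maps between posets of faces -/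

namespace Faces

open scoped Classical in
/-- The monotone map which sends a nonempty subset `S` to the set of the elements related to some
element of `S` by a left-total relation. -/
def ofRel {m n : ℕ} (R : Fin (m + 1) → Fin (n + 1) → Prop) (hR : ∀ j, ∃ i, R j i) :
    Faces.{u} m →o Faces.{u} n where
  toFun S :=
    { finset := Finset.univ.filter (fun i => ∃ j ∈ S.finset, R j.down i.down)
      nonempty := by
        obtain ⟨j, hj⟩ := S.nonempty
        obtain ⟨i, hi⟩ := hR j.down
        exact ⟨⟨i⟩, by simpa using ⟨j.down, hj, hi⟩⟩
      comparable := fun a b => le_total a.1 b.1 }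
  monotone' S T h i hi := by
    simp only [Finset.mem_filter, Finset.mem_univ, true_and] at hi ⊢
    obtain ⟨j, hj, hji⟩ := hi
    exact ⟨j, h hj, hji⟩

open scoped Classical in
theorem mem_ofRel {m n : ℕ} (R : Fin (m + 1) → Fin (n + 1) → Prop) (hR : ∀ j, ∃ i, R j i)
    (S : Faces.{u} m) (i : ULift.{u} (Fin (n + 1))) :
    i ∈ (ofRel R hR S).finset ↔ ∃ j ∈ S.finset, R j.down i.down := by
  change i ∈ Finset.filter _ _ ↔ _
  rw [Finset.mem_filter]
  exact and_iff_right (Finset.mem_univ i)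

/-- Every map of face posets used for the pairing comes from a relation on vertices. Identities
among cofaces, codegeneracies, saturations and collapses thereby reduce to arithmetic with vertices.
-/
theorem ofRel_comp {l m n : ℕ} (R : Fin (m + 1) → Fin (n + 1) → Prop) (hR : ∀ j, ∃ i, R j i)
    (R' : Fin (l + 1) → Fin (m + 1) → Prop) (hR' : ∀ j, ∃ i, R' j i) :
    (ofRel.{u} R hR).comp (ofRel R' hR') = ofRel (Relation.Comp R' R) (fun j => by
      obtain ⟨i, hi⟩ := hR' j
      obtain ⟨t, ht⟩ := hR i
      exact ⟨t, i, hi, ht⟩) := by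
  ext S t
  simp only [OrderHom.comp_coe, Function.comp_apply, mem_ofRel, Relation.Comp]
  constructor
  · rintro ⟨i, ⟨j, hj, h⟩, h'⟩
    exact ⟨j, hj, i.down, h, h'⟩
  · rintro ⟨j, hj, i, h, h'⟩
    exact ⟨⟨i⟩, ⟨j, hj, h⟩, h'⟩

theorem ofRel_congr {m n : ℕ} {R R' : Fin (m + 1) → Fin (n + 1) → Prop} {hR : ∀ j, ∃ i, R j i}
    {hR' : ∀ j, ∃ i, R' j i} (h : ∀ j i, R j i ↔ R' j i) : ofRel.{u} R hR = ofRel R' hR' := by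
  obtain rfl : R = R' := by
    ext j i
    exact h j i
  rfl

/-- The monotone map between posets of nonempty subsets given by taking images. -/
def image {m n : ℕ} (α : Fin (m + 1) →o Fin (n + 1)) : Faces.{u} m →o Faces.{u} n :=
  ofRel (fun j i => α j = i) (fun _ => ⟨_, rfl⟩)

/-- The idempotent map which adds to `S` all the elements bounded above by some `j ∈ S` with
`k ≤ j`. -/
def saturate (k n : ℕ) : Faces.{u} n →o Faces.{u} n :=
  ofRel (fun j i => j = i ∨ k ≤ j.val ∧ i ≤ j) (fun j => ⟨j, Or.inl rfl⟩)

theorem image_comp {l m n : ℕ} (α : Fin (m + 1) →o Fin (n + 1)) (β : Fin (l + 1) →o Fin (m + 1)) :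
    (image.{u} α).comp (image β) = image (α.comp β) := by
  rw [image, image, ofRel_comp]
  exact ofRel_congr (fun j i => by simp [Relation.Comp])

theorem saturate_comp_of_le {k l : ℕ} (h : k ≤ l) (n : ℕ) :
    (saturate.{u} k n).comp (saturate l n) = saturate k n := by
  rw [saturate, saturate, ofRel_comp]
  refine ofRel_congr (fun j i => ⟨?_, fun hji => ⟨j, Or.inl rfl, hji⟩⟩)
  rintro ⟨t, ht, ht'⟩
  grind

theorem saturate_of_lt {k n : ℕ} (h : n < k) : saturate.{u} k n = OrderHom.id := by
  ext S i
  rw [saturate, mem_ofRel]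
  constructor
  · rintro ⟨j, hj, hji | ⟨hk, -⟩⟩
    · obtain rfl : j = i := ULift.ext _ _ hji
      exact hj
    · have := j.down.isLt
      omega
  · exact fun hi => ⟨i, hi, Or.inl rfl⟩

/-- By monotonicity of `α`, whatever the inner saturation adds is added by the outer one anyway.
Read contravariantly, restriction along `α` turns `l`-saturated simplices into `k`-saturated ones.
-/
theorem saturate_comp_image_comp_saturate {k l m n : ℕ} (α : Fin (m + 1) →o Fin (n + 1))
    (h : ∀ j, k ≤ j.val → l ≤ (α j).val) :
    (saturate.{u} l n).comp ((image α).comp (saturate k m)) =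
      (saturate l n).comp (image α) := by
  simp only [saturate, image, ofRel_comp]
  refine ofRel_congr (fun j i => ?_)
  simp only [Relation.Comp]
  constructor
  · rintro ⟨b, ⟨c, rfl | ⟨hk, hc⟩, rfl⟩, hb⟩
    · exact ⟨_, rfl, hb⟩
    · refine ⟨_, rfl, Or.inr ⟨h j hk, ?_⟩⟩
      have := α.monotone hc
      obtain rfl | ⟨-, hb⟩ := hb
      · exact this
      · exact hb.trans this
  · rintro ⟨b, rfl, hb⟩
    exact ⟨_, ⟨j, Or.inl rfl, rfl⟩, hb⟩

/-- Surjectivity provides a preimage for each element that saturation adds after taking images. This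
lets a degeneracy pass through saturation. -/
theorem image_comp_saturate {k l m n : ℕ} (α : Fin (m + 1) →o Fin (n + 1))
    (hα : Function.Surjective α) (h : ∀ j, k ≤ j.val ↔ l ≤ (α j).val) :
    (image.{u} α).comp (saturate k m) = (saturate l n).comp (image α) := by
  simp only [saturate, image, ofRel_comp]
  refine ofRel_congr (fun j i => ?_)
  simp only [Relation.Comp]
  constructor
  · rintro ⟨b, rfl | ⟨hk, hc⟩, rfl⟩
    · exact ⟨_, rfl, Or.inl rfl⟩
    · exact ⟨_, rfl, Or.inr ⟨(h j).1 hk, α.monotone hc⟩⟩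
  · rintro ⟨b, rfl, rfl | ⟨hl, hb⟩⟩
    · exact ⟨j, Or.inl rfl, rfl⟩
    · obtain ⟨c, rfl⟩ := hα i
      by_cases hc : c ≤ j
      · exact ⟨c, Or.inr ⟨(h j).2 hl, hc⟩, rfl⟩
      · exact ⟨j, Or.inl rfl, le_antisymm (α.monotone (le_of_not_ge hc)) hb⟩

/-- The monotone map which sends `k + 1` to `k` and fixes all other elements. -/
def collapse (k n : ℕ) : Fin (n + 1) →o Fin (n + 1) where
  toFun j := if h : j.val = k + 1 then ⟨k, by omega⟩ else j
  monotone' a b h := by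
    simp only [Fin.le_def] at h ⊢
    split_ifs <;> simp <;> omega

theorem collapse_val (k n : ℕ) (j : Fin (n + 1)) :
    (collapse k n j).val = if j.val = k + 1 then k else j.val := by
  change (dite _ _ _ : Fin (n + 1)).val = _
  split_ifs <;> rfl

/-- The `i`-th coface map. -/
def δ {n : ℕ} (i : Fin (n + 2)) : Fin (n + 1) →o Fin (n + 2) := (SimplexCategory.δ i).toOrderHom

/-- The `i`-th codegeneracy map. -/
def σ {n : ℕ} (i : Fin (n + 1)) : Fin (n + 2) →o Fin (n + 1) := (SimplexCategory.σ i).toOrderHom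

theorem δ_val {n : ℕ} (i : Fin (n + 2)) (j : Fin (n + 1)) :
    (δ i j).val = if j.val < i.val then j.val else j.val + 1 := by
  change (i.succAbove j).val = _
  simp only [Fin.succAbove, Fin.lt_def]
  split_ifs <;> simp_all

theorem σ_val {n : ℕ} (i : Fin (n + 1)) (j : Fin (n + 2)) :
    (σ i j).val = if j.val ≤ i.val then j.val else j.val - 1 := by
  change (i.predAbove j).val = _
  by_cases h : i.castSucc < j
  · rw [Fin.predAbove_of_castSucc_lt _ _ h, if_neg (by simpa [Fin.lt_def] using h)]
    rfl
  · rw [Fin.predAbove_of_le_castSucc _ _ (le_of_not_gt h),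
      if_pos (by simpa [Fin.lt_def] using h)]
    rfl

theorem σ_comp_saturate_comp_δ {n : ℕ} (k : Fin (n + 1)) :
    (image.{u} (σ k)).comp ((saturate (k.val + 1) (n + 1)).comp (image (δ k.succ))) =
      saturate (k.val + 1) n := by
  simp only [saturate, image, ofRel_comp]
  refine ofRel_congr (fun j i => ?_)
  simp only [Relation.Comp, Fin.ext_iff, Fin.le_def]
  constructor
  · rintro ⟨c, ⟨b, hb, hc⟩, hi⟩
    rw [σ_val] at hi
    rw [δ_val] at hb
    simp only [Fin.val_succ] at hb
    split_ifs at * <;> omega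
  · intro h
    refine ⟨δ k.succ i, ⟨δ k.succ j, rfl, ?_⟩, ?_⟩
    · simp only [δ_val, Fin.val_succ]
      split_ifs <;> omega
    · simp only [δ_val, σ_val, Fin.val_succ]
      split_ifs <;> omega

theorem saturate_σ_saturate_δ_rel {n : ℕ} (k : Fin (n + 1)) (i : Fin (n + 2))
    (hi : k.val + 2 ≤ i.val) :
    (saturate.{u} (k.val + 1) n).comp ((image (σ k)).comp ((saturate (k.val + 1) (n + 1)).comp
      (image (δ i)))) =
    ofRel (fun j t => if j ≤ k then t = j else t ≤ σ k (δ i j))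
      (fun j => by split_ifs; exacts [⟨_, rfl⟩, ⟨_, le_rfl⟩]) := by
  simp only [saturate, image, ofRel_comp]
  refine ofRel_congr (fun j t => ?_)
  simp only [Relation.Comp, Fin.ext_iff, Fin.le_def]
  constructor
  · rintro ⟨f, ⟨e, ⟨d, hd, he⟩, hf⟩, ht⟩
    rw [δ_val] at hd
    rw [σ_val] at hf
    rw [σ_val, δ_val]
    split_ifs at * <;> omega
  · intro h
    by_cases hj : j.val ≤ k.val
    · rw [if_pos hj] at h
      exact ⟨j, ⟨δ i j, ⟨_, rfl, Or.inl rfl⟩, by rw [σ_val, δ_val]; split_ifs <;> omega⟩,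
        Or.inl h.symm⟩
    · rw [if_neg hj] at h
      by_cases hj' : j.val = k.val + 1
      · have hle : t.val ≤ k.val := by
          rw [σ_val, δ_val] at h
          split_ifs at h <;> omega
        refine ⟨t, ⟨δ i t, ⟨_, rfl, Or.inr ?_⟩, by rw [σ_val, δ_val]; split_ifs <;> omega⟩,
          Or.inl rfl⟩
        simp only [δ_val]
        split_ifs <;> omega
      · refine ⟨_, ⟨_, ⟨_, rfl, Or.inl rfl⟩, rfl⟩, Or.inr ⟨?_, h⟩⟩
        rw [σ_val, δ_val]
        split_ifs <;> omega

/-- The only vertex that could cause trouble is `k + 1`. By `saturate_σ_saturate_δ_rel` it is sent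
to `{0, ..., k}`, and this is also what results from first saturating it and collapsing `k + 1` onto
`k`. Consequently the faces of `extend k y` beyond `k + 1` are `k`-collapsible. -/
theorem saturate_σ_saturate_δ_collapse_saturate {n : ℕ} (k : Fin (n + 1)) (i : Fin (n + 2))
    (hi : k.val + 2 ≤ i.val) :
    (saturate.{u} (k.val + 1) n).comp ((image (σ k)).comp ((saturate (k.val + 1) (n + 1)).comp
      ((image (δ i)).comp ((image (collapse k.val n)).comp (saturate (k.val + 1) n))))) =
    (saturate.{u} (k.val + 1) n).comp ((image (σ k)).comp ((saturate (k.val + 1) (n + 1)).comp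
      (image (δ i)))) := by
  rw [← OrderHom.comp_assoc, ← OrderHom.comp_assoc, ← OrderHom.comp_assoc, ← OrderHom.comp_assoc,
    OrderHom.comp_assoc (saturate (k.val + 1) n), OrderHom.comp_assoc (saturate (k.val + 1) n),
    OrderHom.comp_assoc (image (σ k)), saturate_σ_saturate_δ_rel k i hi]
  simp only [saturate, image, ofRel_comp]
  refine ofRel_congr (fun j t => ?_)
  simp only [Relation.Comp, Fin.ext_iff, Fin.le_def, σ_val, δ_val]
  constructor
  · rintro ⟨b, hb, c, hc, ht⟩
    rw [collapse_val] at hc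
    split_ifs at * <;> omega
  · intro h
    by_cases hj : j.val = k.val + 1
    · have hle : t.val ≤ k.val := by split_ifs at h <;> omega
      refine ⟨t, Or.inr ⟨by omega, by omega⟩, t, ?_, by rw [if_pos hle]⟩
      rw [collapse_val, if_neg (by omega)]
    · exact ⟨j, Or.inl rfl, j, by rw [collapse_val, if_neg hj], h⟩

/-- The left-hand composite sends both `k + 1` and `k + 2` to `{0, ..., k}`, while the extra factor
on the right only moves `k + 1` to `k + 2`. It follows that extending a `k`-collapsible simplex
gives a degenerate one. -/
theorem collapse_saturate_σ_saturate {n : ℕ} (k : Fin (n + 1)) (k' : Fin (n + 1))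
    (hk : k'.val = k.val + 1) :
    (image.{u} (collapse k.val n)).comp ((saturate (k.val + 1) n).comp ((image (σ k)).comp
      (saturate (k.val + 1) (n + 1)))) =
    (image.{u} (collapse k.val n)).comp ((saturate (k.val + 1) n).comp ((image (σ k)).comp
      ((saturate (k.val + 1) (n + 1)).comp (image ((δ k'.castSucc).comp (σ k')))))) := by
  have key : (image.{u} (collapse k.val n)).comp ((saturate (k.val + 1) n).comp ((image (σ k)).comp
      (saturate (k.val + 1) (n + 1)))) =
      ofRel (fun j t => if j.val ≤ k.val then t.val = j.val else
        t.val ≤ j.val - 1 ∧ t.val ≠ k.val + 1) (fun j => by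
          by_cases h : j.val ≤ k.val
          · exact ⟨⟨j.val, by omega⟩, by rw [if_pos h]⟩
          · exact ⟨⟨k.val, by omega⟩, by rw [if_neg h]; constructor <;> simp; omega⟩) := by
    simp only [saturate, image, ofRel_comp]
    refine ofRel_congr (fun j t => ?_)
    simp only [Relation.Comp, Fin.ext_iff, Fin.le_def]
    constructor
    · rintro ⟨d, ⟨c, ⟨b, ha, hb⟩, hc⟩, hd⟩
      rw [σ_val] at hb
      rw [collapse_val] at hd
      split_ifs at * <;> omega
    · intro h
      by_cases hj : j.val ≤ k.val
      · rw [if_pos hj] at h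
        refine ⟨t, ⟨t, ⟨j, Or.inl rfl, ?_⟩, Or.inl rfl⟩, ?_⟩
        · rw [σ_val, if_pos hj, h]
        · rw [collapse_val, if_neg (by omega)]
      · rw [if_neg hj] at h
        by_cases hj' : j.val = k.val + 1
        · refine ⟨t, ⟨t, ⟨⟨t.val, by omega⟩, Or.inr ⟨?_, ?_⟩, ?_⟩, Or.inl rfl⟩, ?_⟩
          · omega
          · simp only; omega
          · rw [σ_val, if_pos (by simp only; omega)]
          · rw [collapse_val, if_neg (by omega)]
        · refine ⟨t, ⟨σ k j, ⟨j, Or.inl rfl, rfl⟩, Or.inr ⟨?_, ?_⟩⟩, ?_⟩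
          · rw [σ_val, if_neg hj]; omega
          · rw [σ_val, if_neg hj]; exact h.1
          · rw [collapse_val, if_neg h.2]
  have key' := congrArg (fun f => OrderHom.comp f (image.{u} ((δ k'.castSucc).comp (σ k')))) key
  simp only [OrderHom.comp_assoc] at key'
  rw [key, key', image, ofRel_comp]
  refine ofRel_congr (fun j t => ?_)
  simp only [Relation.Comp, exists_eq_left', OrderHom.comp_coe, Function.comp_apply, δ_val, σ_val,
    Fin.val_castSucc]
  split_ifs <;> omega

/-- The map of nerves induced by a monotone map, as a map `sd Δ[m] ⟶ sd Δ[n]`. -/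
def sdMap {m n : ℕ} (f : Faces.{u} m →o Faces.{u} n) :
    SimplexCategory.sd.{u}.obj ⦋m⦌ ⟶ SimplexCategory.sd.{u}.obj ⦋n⦌ :=
  nerveMap f.monotone.functor

theorem sdMap_comp {l m n : ℕ} (g : Faces.{u} m →o Faces.{u} n) (f : Faces.{u} l →o Faces.{u} m) :
    sdMap (g.comp f) = sdMap f ≫ sdMap g := rfl

theorem map_eq_image {m n : ℕ} (g : ULift.{u} (Fin (m + 1)) →o ULift.{u} (Fin (n + 1)))
    (α : Fin (m + 1) →o Fin (n + 1)) (h : ∀ i, (g i).down = α i.down) :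
    PartialOrder.NonemptyFiniteChains.orderHomMap g = image α := by
  ext S i
  rw [image, mem_ofRel]
  refine (PartialOrder.NonemptyFiniteChains.mem_map_iff S g i).trans
    ⟨fun ⟨x, hx, hxi⟩ => ⟨x, hx, by rw [← h, hxi]⟩, fun ⟨x, hx, hxi⟩ => ⟨x, hx, ?_⟩⟩
  exact ULift.ext _ _ ((h x).trans hxi)

theorem sd_map {m n : ℕ} (α : ⦋m⦌ ⟶ ⦋n⦌) :
    SimplexCategory.sd.{u}.map α = sdMap (image α.toOrderHom) := by
  change nerveMap (PartialOrder.NonemptyFiniteChains.orderHomMap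
    (SimplexCategory.toPartOrd.{u}.map α).hom).monotone.functor = _
  have := map_eq_image (SimplexCategory.toPartOrd.{u}.map α).hom α.toOrderHom (fun _ => rfl)
  exact congrArg sdMap this

end Faces

open Faces

/-! ### Saturated and collapsible simplices of `Ex X` -/

variable {X : SSet.{u}}

/-- Precomposition of a simplex `sd Δ[n] ⟶ X` of `Ex X` with the map induced by a monotone map. -/
def pull {m n : ℕ} (f : Faces.{u} m →o Faces.{u} n) (y : (SSet.ex.{u}.obj X) _⦋n⦌) :
    (SSet.ex.{u}.obj X) _⦋m⦌ :=
  ULift.up (sdMap f ≫ y.down)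

theorem pull_pull {l m n : ℕ} (f : Faces.{u} l →o Faces.{u} m) (g : Faces.{u} m →o Faces.{u} n)
    (y : (SSet.ex.{u}.obj X) _⦋n⦌) : pull f (pull g y) = pull (g.comp f) y := by
  rw [pull, pull, pull, sdMap_comp, Category.assoc]

theorem pull_id {n : ℕ} (y : (SSet.ex.{u}.obj X) _⦋n⦌) : pull OrderHom.id y = y := rfl

theorem ex_map {m n : ℕ} (α : ⦋m⦌ ⟶ ⦋n⦌) (y : (SSet.ex.{u}.obj X) _⦋n⦌) :
    (SSet.ex.{u}.obj X).map α.op y = pull (image α.toOrderHom) y := by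
  rw [pull, ← sd_map]
  rfl

theorem ex_δ {n : ℕ} (i : Fin (n + 2)) (y : (SSet.ex.{u}.obj X) _⦋n + 1⦌) :
    (SSet.ex.{u}.obj X).δ i y = pull (image (Faces.δ i)) y :=
  ex_map (SimplexCategory.δ i) y

theorem ex_σ {n : ℕ} (i : Fin (n + 1)) (y : (SSet.ex.{u}.obj X) _⦋n⦌) :
    (SSet.ex.{u}.obj X).σ i y = pull (image (Faces.σ i)) y :=
  ex_map (SimplexCategory.σ i) y

/-- A simplex `y : sd Δ[n] ⟶ X` of `Ex X` is `k`-saturated if it is invariant under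
`Faces.saturate k n`. -/
def IsSaturated (k : ℕ) {n : ℕ} (y : (SSet.ex.{u}.obj X) _⦋n⦌) : Prop :=
  pull (saturate k n) y = y

/-- A simplex of `Ex X` is `k`-collapsible if it is invariant under the map induced by
`Faces.collapse k n` and saturation. -/
def IsCollapsible (k : ℕ) {n : ℕ} (y : (SSet.ex.{u}.obj X) _⦋n⦌) : Prop :=
  k + 1 ≤ n ∧ pull ((image (collapse k n)).comp (saturate (k + 1) n)) y = y

theorem IsSaturated.mono {k l n : ℕ} (h : k ≤ l) {y : (SSet.ex.{u}.obj X) _⦋n⦌}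
    (hy : IsSaturated k y) : IsSaturated l y := by
  rw [IsSaturated, ← hy, pull_pull, saturate_comp_of_le h]

theorem isSaturated_of_lt {k n : ℕ} (h : n < k) (y : (SSet.ex.{u}.obj X) _⦋n⦌) :
    IsSaturated k y := by
  rw [IsSaturated, saturate_of_lt h, pull_id]

theorem isSaturated_pull_saturate (k : ℕ) {n : ℕ} (y : (SSet.ex.{u}.obj X) _⦋n⦌) :
    IsSaturated k (pull (saturate k n) y) := by
  rw [IsSaturated, pull_pull, saturate_comp_of_le le_rfl]

theorem IsSaturated.pull_image {k l m n : ℕ} {y : (SSet.ex.{u}.obj X) _⦋n⦌}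
    (hy : IsSaturated l y) (α : Fin (m + 1) →o Fin (n + 1))
    (h : ∀ j, k ≤ j.val → l ≤ (α j).val) : IsSaturated k (pull (image α) y) := by
  rw [IsSaturated]
  conv_lhs => rw [← hy]
  conv_rhs => rw [← hy]
  rw [pull_pull, pull_pull, pull_pull, ← saturate_comp_image_comp_saturate α h]

/-- The `(k + 1)`-saturated simplex of dimension `n + 1` obtained from an `n`-simplex `y` of `Ex X`
by saturating its `k`-th degeneracy; if `y` is `(k + 1)`-saturated, its face opposite to `k + 1`
is `y`. -/
def extend {n : ℕ} (k : Fin (n + 1)) (y : (SSet.ex.{u}.obj X) _⦋n⦌) :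
    (SSet.ex.{u}.obj X) _⦋n + 1⦌ :=
  pull (saturate (k.val + 1) (n + 1)) (pull (image (Faces.σ k)) y)

section

variable {n : ℕ} {k : Fin (n + 1)} {y : (SSet.ex.{u}.obj X) _⦋n⦌}

theorem δ_extend (hy : IsSaturated (k.val + 1) y) :
    (SSet.ex.{u}.obj X).δ k.succ (extend k y) = y := by
  rw [ex_δ, extend, pull_pull, pull_pull, σ_comp_saturate_comp_δ]
  exact hy

theorem isSaturated_extend : IsSaturated (k.val + 1) (extend k y) :=
  isSaturated_pull_saturate _ _

theorem IsSaturated.δ_of_le {z : (SSet.ex.{u}.obj X) _⦋n + 1⦌} {l : ℕ} (hz : IsSaturated l z)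
    (i : Fin (n + 2)) : IsSaturated l ((SSet.ex.{u}.obj X).δ i z) := by
  rw [ex_δ]
  refine hz.pull_image _ (fun j hj => ?_)
  rw [δ_val]
  split_ifs <;> omega

theorem IsSaturated.δ_of_lt {z : (SSet.ex.{u}.obj X) _⦋n + 1⦌} {l : ℕ} (hz : IsSaturated (l + 1) z)
    (i : Fin (n + 2)) (hi : i.val ≤ l) : IsSaturated l ((SSet.ex.{u}.obj X).δ i z) := by
  rw [ex_δ]
  refine hz.pull_image _ (fun j hj => ?_)
  rw [δ_val]
  split_ifs <;> omega

theorem not_isSaturated_extend (hy : IsSaturated (k.val + 1) y) (hy' : ¬ IsSaturated k.val y) :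
    ¬ IsSaturated k.val (extend k y) := fun h => hy' (by
  rw [← δ_extend hy]
  exact h.δ_of_le _)

theorem isCollapsible_δ_extend (hy : IsSaturated (k.val + 1) y) (i : Fin (n + 2))
    (hi : k.val + 2 ≤ i.val) :
    IsCollapsible k.val ((SSet.ex.{u}.obj X).δ i (extend k y)) := by
  refine ⟨by omega, ?_⟩
  rw [ex_δ, extend]
  conv_lhs => rw [← hy]
  conv_rhs => rw [← hy]
  simp only [pull_pull, OrderHom.comp_assoc]
  rw [saturate_σ_saturate_δ_collapse_saturate k i hi]

theorem collapse_eq (k : Fin (n + 1)) :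
    collapse k.val (n + 1) = (Faces.δ k.succ).comp (Faces.σ k) := by
  ext j
  simp only [collapse_val, OrderHom.comp_coe, Function.comp_apply, δ_val, σ_val, Fin.val_succ]
  split_ifs <;> omega

theorem isCollapsible_iff {z : (SSet.ex.{u}.obj X) _⦋n + 1⦌} :
    IsCollapsible k.val z ↔ extend k ((SSet.ex.{u}.obj X).δ k.succ z) = z := by
  rw [IsCollapsible, and_iff_right (by omega), ex_δ, extend, pull_pull, pull_pull, collapse_eq,
    ← image_comp, OrderHom.comp_assoc]

theorem isCollapsible_extend (hy : IsSaturated (k.val + 1) y) :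
    IsCollapsible k.val (extend k y) := by
  rw [isCollapsible_iff, δ_extend hy]

/-- Faces of index at most `k` are `k`-saturated and faces of index above `k + 1` are
`k`-collapsible, whereas `y` is neither. -/
theorem extend_ne_σ (hy : IsSaturated (k.val + 1) y) (hy' : ¬ IsSaturated k.val y)
    (hy'' : ¬ IsCollapsible k.val y) (i : Fin (n + 2)) (hi : i ≠ k.succ) :
    (SSet.ex.{u}.obj X).δ i (extend k y) ≠ y := by
  intro h
  obtain hi' | hi' := Nat.lt_or_ge k.val i.val
  · refine hy'' (h ▸ isCollapsible_δ_extend hy i ?_)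
    have : i.val ≠ k.val + 1 := fun h => hi (Fin.ext h)
    omega
  · exact hy' (h ▸ isSaturated_extend.δ_of_lt i hi')

/-- A simplex degenerate along `σ i` has equal faces `i` and `i + 1`. If one of these is the face `k
+ 1`, then `y` recurs as another face, against `extend_ne_σ`. Otherwise `y` is the restriction of
`w` along an operator identifying two vertices, against its nondegeneracy. -/
theorem extend_mem_nonDegenerate (hy : IsSaturated (k.val + 1) y) (hy' : ¬ IsSaturated k.val y)
    (hy'' : ¬ IsCollapsible k.val y) (hn : y ∈ (SSet.ex.{u}.obj X).nonDegenerate n) :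
    extend k y ∈ (SSet.ex.{u}.obj X).nonDegenerate (n + 1) := by
  rw [SSet.mem_nonDegenerate_iff_notMem_degenerate, SSet.degenerate_eq_iUnion_range_σ]
  intro h
  obtain ⟨i, w, hw⟩ := Set.mem_iUnion.1 h
  have h₁ := (SSet.ex.{u}.obj X).δ_comp_σ_self_apply i w
  have h₂ := (SSet.ex.{u}.obj X).δ_comp_σ_succ_apply i w
  rw [hw] at h₁ h₂
  have hδ := δ_extend hy
  by_cases h₃ : k.succ = i.castSucc
  · rw [← h₃, hδ] at h₁
    exact extend_ne_σ hy hy' hy'' i.succ (by rw [h₃]; exact i.castSucc_lt_succ.ne')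
      (h₂.trans h₁.symm)
  by_cases h₄ : k.succ = i.succ
  · rw [← h₄, hδ] at h₂
    exact extend_ne_σ hy hy' hy'' i.castSucc (Ne.symm h₃) (h₁.trans h₂.symm)
  obtain ⟨a, ha⟩ := Fin.exists_succAbove_eq (Ne.symm h₃)
  obtain ⟨b, hb⟩ := Fin.exists_succAbove_eq (Ne.symm h₄)
  have := SSet.mono_of_nonDegenerate _ ⟨y, hn⟩
    (SimplexCategory.δ k.succ ≫ SimplexCategory.σ i) w (by
    rw [op_comp, Functor.map_comp]
    exact (congrArg ((SSet.ex.{u}.obj X).δ k.succ) hw).trans hδ)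
  have hab : a = b := (SimplexCategory.mono_iff_injective.1 this) (by
    change i.predAbove (k.succ.succAbove a) = i.predAbove (k.succ.succAbove b)
    rw [ha, hb]
    simp)
  rw [hab, hb] at ha
  exact i.castSucc_lt_succ.ne' ha

/-- If the face were `k`-saturated, so would be its `k`-th degeneracy. Saturating that degeneracy
would change nothing, and `z` would be degenerate. -/
theorem IsCollapsible.not_isSaturated_δ {z : (SSet.ex.{u}.obj X) _⦋n + 1⦌}
    (hz : IsCollapsible k.val z) (hn : z ∈ (SSet.ex.{u}.obj X).nonDegenerate (n + 1)) :
    ¬ IsSaturated k.val ((SSet.ex.{u}.obj X).δ k.succ z) := by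
  intro h
  rw [isCollapsible_iff] at hz
  refine hn ?_
  rw [← hz, extend]
  have h' : IsSaturated k.val (pull (image (Faces.σ k)) ((SSet.ex.{u}.obj X).δ k.succ z)) :=
    h.pull_image _ (fun j hj => by rw [σ_val]; split_ifs <;> omega)
  rw [h'.mono (Nat.le_succ _), ← ex_σ]
  exact SSet.σ_mem_degenerate _ _ _

theorem IsCollapsible.not_isCollapsible_δ {z : (SSet.ex.{u}.obj X) _⦋n + 1⦌}
    (hz : IsCollapsible k.val z) (hn : z ∈ (SSet.ex.{u}.obj X).nonDegenerate (n + 1)) :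
    ¬ IsCollapsible k.val ((SSet.ex.{u}.obj X).δ k.succ z) := by
  intro h
  rw [isCollapsible_iff] at hz
  have hlt := h.1
  let k' : Fin (n + 1) := ⟨k.val + 1, by omega⟩
  refine hn ?_
  have hz' : z = pull (image ((Faces.δ k'.castSucc).comp (Faces.σ k'))) z := by
    conv_rhs => rw [← hz]
    conv_lhs => rw [← hz]
    rw [extend]
    conv_lhs => rw [← h.2]
    conv_rhs => rw [← h.2]
    simp only [pull_pull, OrderHom.comp_assoc]
    exact congrArg (fun f => pull f _) (collapse_saturate_σ_saturate k k' rfl)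
  rw [hz', ← image_comp, ← pull_pull, ← ex_σ]
  exact SSet.σ_mem_degenerate _ _ _

theorem pull_saturate_σ_mem_degenerate {l l' : ℕ} (i : Fin (n + 1))
    (h : ∀ j, l ≤ j.val ↔ l' ≤ (Faces.σ i j).val) (w : (SSet.ex.{u}.obj X) _⦋n⦌) :
    pull (saturate l (n + 1)) (pull (image (Faces.σ i)) w) ∈
      (SSet.ex.{u}.obj X).degenerate (n + 1) := by
  have hsurj : Function.Surjective (Faces.σ i) := fun j =>
    ⟨Faces.δ i.castSucc j, by
      ext
      simp only [σ_val, δ_val, Fin.val_castSucc]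
      split_ifs <;> omega⟩
  rw [pull_pull, image_comp_saturate _ hsurj h, ← pull_pull, ← ex_σ]
  exact SSet.σ_mem_degenerate _ _ _

/-- Suppose the face is `σ i` of some `w`. For `i ≠ k` this degeneracy commutes past `σ k` and past
saturation, making `z` degenerate. For `i = k` the face is `k`-saturated, which
`IsCollapsible.not_isSaturated_δ` excludes. -/
theorem IsCollapsible.δ_mem_nonDegenerate {z : (SSet.ex.{u}.obj X) _⦋n + 1⦌}
    (hz : IsCollapsible k.val z) (hn : z ∈ (SSet.ex.{u}.obj X).nonDegenerate (n + 1))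
    (hs : IsSaturated (k.val + 1) z) :
    (SSet.ex.{u}.obj X).δ k.succ z ∈ (SSet.ex.{u}.obj X).nonDegenerate n := by
  have hz₁ := hz.not_isSaturated_δ hn
  have hs₁ := hs.δ_of_le k.succ
  rw [isCollapsible_iff] at hz
  revert hz hz₁ hs₁
  generalize (SSet.ex.{u}.obj X).δ k.succ z = y
  intro hz hz₁ hs₁
  obtain _ | n := n
  · simp
  rw [SSet.mem_nonDegenerate_iff_notMem_degenerate, SSet.degenerate_eq_iUnion_range_σ]
  intro h
  obtain ⟨i, w, rfl⟩ := Set.mem_iUnion.1 h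
  rw [ex_σ] at hz hz₁ hs₁
  obtain hlt | heq | hgt := lt_trichotomy i.val k.val
  · have hcomp : (Faces.σ i).comp (Faces.σ k) =
        (Faces.σ ⟨k.val - 1, by omega⟩).comp (Faces.σ i.castSucc) := by
      ext j
      simp only [OrderHom.comp_coe, Function.comp_apply, σ_val, Fin.val_castSucc]
      split_ifs <;> omega
    refine hn ?_
    rw [← hz, extend, pull_pull (image (Faces.σ k)), image_comp, hcomp, ← image_comp, ← pull_pull]
    refine pull_saturate_σ_mem_degenerate (l' := k.val) _ (fun j => ?_) _
    rw [σ_val, Fin.val_castSucc]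
    split_ifs <;> omega
  · refine hz₁ ?_
    have hw : IsSaturated k.val w := by
      have := hs₁.δ_of_lt i.castSucc (by simp [heq])
      rwa [← ex_σ, SSet.δ_comp_σ_self_apply] at this
    refine hw.pull_image _ (fun j hj => ?_)
    rw [σ_val]
    split_ifs <;> omega
  · have hcomp : (Faces.σ i).comp (Faces.σ k) =
        (Faces.σ ⟨k.val, by omega⟩).comp (Faces.σ i.succ) := by
      ext j
      simp only [OrderHom.comp_coe, Function.comp_apply, σ_val, Fin.val_succ]
      split_ifs <;> omega
    refine hn ?_
    rw [← hz, extend, pull_pull (image (Faces.σ k)), image_comp, hcomp, ← image_comp, ← pull_pull]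
    refine pull_saturate_σ_mem_degenerate (l' := k.val + 1) _ (fun j => ?_) _
    rw [σ_val, Fin.val_succ]
    split_ifs <;> omega

end

/-! ### The map `X ⟶ Ex X` -/

/-- The initial segment of `{0, ..., n}` with a given greatest element. -/
def initialSegment (n : ℕ) : Fin (n + 1) →o Faces.{u} n where
  toFun j :=
    { finset := Finset.univ.filter (fun i => i.down ≤ j)
      nonempty := ⟨⟨j⟩, by simp⟩
      comparable := fun a b => le_total a.1 b.1 }
  monotone' j j' h i hi := by
    simp only [Finset.mem_filter, Finset.mem_univ, true_and] at hi ⊢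
    exact hi.trans h

theorem initialSegment_lastVertexHom (n : ℕ) :
    (initialSegment.{u} n).comp (lastVertexHom n) = saturate 0 n := by
  ext S i
  rw [saturate, mem_ofRel]
  change i ∈ Finset.filter _ _ ↔ _
  rw [Finset.mem_filter, and_iff_right (Finset.mem_univ i)]
  constructor
  · exact fun h => ⟨_, Finset.max'_mem _ S.nonempty, Or.inr ⟨Nat.zero_le _, h⟩⟩
  · rintro ⟨j, hj, h⟩
    have h₁ : j.down ≤ lastVertexHom n S := Finset.le_max' S.finset j hj
    obtain h | ⟨-, h⟩ := h
    · exact h ▸ h₁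
    · exact h.trans h₁

theorem lastVertexHom_initialSegment (n : ℕ) (j : Fin (n + 1)) :
    lastVertexHom.{u} n (initialSegment n j) = j := by
  apply le_antisymm
  · have := Finset.max'_mem _ (initialSegment.{u} n j).nonempty
    exact (Finset.mem_filter.1 this).2
  · exact Finset.le_max' (initialSegment.{u} n j).finset ⟨j⟩
      (Finset.mem_filter.2 ⟨Finset.mem_univ _, le_rfl⟩)

/-- The section `Δ[n] ⟶ sd Δ[n]` of the last-vertex map which is given by initial segments. -/
def initialSegmentMap (n : ℕ) : Δ[n] ⟶ SimplexCategory.sd.{u}.obj ⦋n⦌ where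
  app _ := ↾fun x =>
    ((initialSegment.{u} n).comp (SSet.stdSimplex.objEquiv x).toOrderHom).monotone.functor
  naturality _ _ _ := rfl

theorem initialSegmentMap_lastVertex (n : ℕ) :
    initialSegmentMap.{u} n ≫ lastVertex.app ⦋n⦌ = 𝟙 _ := by
  ext k x
  refine SSet.stdSimplex.objEquiv.injective ?_
  ext i : 3
  exact lastVertexHom_initialSegment _ _

theorem lastVertex_initialSegmentMap (n : ℕ) :
    lastVertex.app ⦋n⦌ ≫ initialSegmentMap.{u} n = sdMap (saturate 0 n) := by
  rw [← initialSegment_lastVertexHom]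
  rfl

/-- `saturate 0 n` induces the idempotent of `sd Δ[n]` obtained from the last-vertex map followed by
its section, so invariance under it means factoring through the last-vertex map. -/
theorem mem_range_toEx_iff {n : ℕ} (y : (SSet.ex.{u}.obj X) _⦋n⦌) :
    y ∈ (SSet.Subcomplex.range (toEx.app X)).obj (op ⦋n⦌) ↔ IsSaturated 0 y := by
  constructor
  · rintro ⟨x, rfl⟩
    refine ULift.ext _ _ ?_
    change sdMap _ ≫ lastVertex.app ⦋n⦌ ≫ _ = lastVertex.app ⦋n⦌ ≫ _
    rw [← lastVertex_initialSegmentMap, Category.assoc]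
    erw [reassoc_of% initialSegmentMap_lastVertex n]
  · intro hy
    refine ⟨SSet.yonedaEquiv (initialSegmentMap n ≫ y.down), ?_⟩
    refine Eq.trans (ULift.ext _ _ ?_) hy
    change lastVertex.app ⦋n⦌ ≫ SSet.yonedaEquiv.symm (SSet.yonedaEquiv _) = sdMap _ ≫ _
    rw [Equiv.symm_apply_apply, ← lastVertex_initialSegmentMap, Category.assoc]

instance mono_toEx (X : SSet.{u}) : Mono (toEx.app X) := by
  rw [NatTrans.mono_iff_mono_app]
  rintro ⟨⟨n⟩⟩
  rw [mono_iff_injective]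
  intro x y h
  have h' : lastVertex.app ⦋n⦌ ≫ SSet.yonedaEquiv.symm x =
      lastVertex.app ⦋n⦌ ≫ SSet.yonedaEquiv.symm y := congrArg ULift.down h
  apply SSet.yonedaEquiv.symm.injective
  have : initialSegmentMap n ≫ lastVertex.app ⦋n⦌ ≫ SSet.yonedaEquiv.symm x =
      initialSegmentMap n ≫ lastVertex.app ⦋n⦌ ≫ SSet.yonedaEquiv.symm y :=
    congrArg (fun f => initialSegmentMap n ≫ f) h'
  erw [reassoc_of% initialSegmentMap_lastVertex n, reassoc_of% initialSegmentMap_lastVertex n]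
    at this
  exact this

/-! ### The pairing of simplices of `Ex X` outside `X` -/

/-- A simplex of type (II) of the pairing for the range of `X ⟶ Ex X`. -/
structure PairingIndex (X : SSet.{u}) where
  /-- the dimension -/
  dim : ℕ
  /-- the simplex -/
  simplex : (SSet.ex.{u}.obj X) _⦋dim⦌
  /-- the level: the simplex is saturated from `level + 1` onwards -/
  level : Fin (dim + 1)
  nonDegenerate : simplex ∈ (SSet.ex.{u}.obj X).nonDegenerate dim
  isSaturated : IsSaturated (level.val + 1) simplex
  not_isSaturated : ¬ IsSaturated level.val simplex
  not_isCollapsible : ¬ IsCollapsible level.val simplex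

theorem level_unique {n : ℕ} {y : (SSet.ex.{u}.obj X) _⦋n⦌} {k l : ℕ}
    (hk : IsSaturated (k + 1) y) (hk' : ¬ IsSaturated k y)
    (hl : IsSaturated (l + 1) y) (hl' : ¬ IsSaturated l y) : k = l := by
  by_contra h
  obtain h | h := Nat.lt_or_gt_of_ne h
  · exact hl' (hk.mono h)
  · exact hk' (hl.mono h)

theorem exists_level {n : ℕ} {y : (SSet.ex.{u}.obj X) _⦋n⦌} (hy : ¬ IsSaturated 0 y) :
    ∃ k : Fin (n + 1), IsSaturated (k.val + 1) y ∧ ¬ IsSaturated k.val y := by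
  classical
  have h : ∃ k, IsSaturated k y := ⟨n + 1, isSaturated_of_lt (Nat.lt_succ_self n) y⟩
  have h₀ : Nat.find h ≠ 0 := fun h' => hy (h' ▸ Nat.find_spec h)
  have h₁ : Nat.find h ≤ n + 1 := Nat.find_min' h (isSaturated_of_lt (Nat.lt_succ_self n) y)
  refine ⟨⟨Nat.find h - 1, by omega⟩, ?_, Nat.find_min h (by simp only; omega)⟩
  have h₂ := Nat.find_spec h
  simp only
  rwa [Nat.sub_add_cancel (by omega)]

namespace PairingIndex

theorem ext_simplex {s t : PairingIndex X} (h : SSet.S.mk s.simplex = SSet.S.mk t.simplex) :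
    s = t := by
  obtain ⟨n, y, k, _, h₁, h₂, _⟩ := s
  obtain ⟨m, z, l, _, h₃, h₄, _⟩ := t
  obtain rfl : n = m := SSet.S.dim_eq_of_eq h
  obtain rfl : y = z := (SSet.S.ext_iff _ _).1 h
  obtain rfl : k = l := Fin.ext (level_unique h₁ h₂ h₃ h₄)
  rfl

end PairingIndex

/-- The pairing for the range of `X ⟶ Ex X`. -/
def toExPairingCore (X : SSet.{u}) : (SSet.Subcomplex.range (toEx.app X)).PairingCore where
  ι := PairingIndex X
  dim s := s.dim
  simplex s := extend s.level s.simplex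
  index s := s.level.succ
  nonDegenerate₁ s := extend_mem_nonDegenerate s.isSaturated s.not_isSaturated s.not_isCollapsible
    s.nonDegenerate
  nonDegenerate₂ s := by
    rw [δ_extend s.isSaturated]
    exact s.nonDegenerate
  notMem₁ s h := not_isSaturated_extend s.isSaturated s.not_isSaturated
    (((mem_range_toEx_iff _).1 h).mono (Nat.zero_le _))
  notMem₂ s h := s.not_isSaturated (by
    rw [δ_extend s.isSaturated] at h
    exact ((mem_range_toEx_iff _).1 h).mono (Nat.zero_le _))
  injective_type₁' {s t} h := by
    obtain ⟨n, y, k, _, h₁, h₂, _⟩ := s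
    obtain ⟨m, z, l, _, h₃, h₄, _⟩ := t
    dsimp only at h
    obtain rfl : n = m := Nat.succ_injective (SSet.S.dim_eq_of_eq h)
    have h' := (SSet.S.ext_iff _ _).1 h
    -- Extension preserves the level, so `k` can be read off from `extend k y`.
    obtain rfl : k = l := by
      have h₅ := not_isSaturated_extend h₁ h₂
      have h₆ : IsSaturated (k.val + 1) (extend k y) := isSaturated_extend
      rw [h'] at h₅ h₆
      exact Fin.ext (level_unique h₆ h₅ isSaturated_extend (not_isSaturated_extend h₃ h₄))
    obtain rfl : y = z := by rw [← δ_extend h₁, h', δ_extend h₃]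
    rfl
  injective_type₂' {s t} h := PairingIndex.ext_simplex (by
    rwa [δ_extend s.isSaturated, δ_extend t.isSaturated] at h)
  type₁_ne_type₂' s t h := by
    rw [δ_extend t.isSaturated] at h
    obtain ⟨n, y, k, _, h₁, h₂, _⟩ := s
    obtain ⟨m, z, l, _, h₃, h₄, h₅⟩ := t
    obtain rfl : n + 1 = m := SSet.S.dim_eq_of_eq h
    obtain rfl : extend k y = z := (SSet.S.ext_iff _ _).1 h
    have := level_unique isSaturated_extend (not_isSaturated_extend h₁ h₂) h₃ h₄
    exact h₅ (this ▸ isCollapsible_extend h₁)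
  surjective' x := by
    obtain ⟨n, x, hx, hx', rfl⟩ := x.mk_surjective
    rw [mem_range_toEx_iff] at hx'
    obtain ⟨k, hk, hk'⟩ := exists_level hx'
    -- A simplex collapsible at its level extends its own face opposite to `k + 1`, hence is of type
    -- (I); any other is of type (II).
    by_cases hc : IsCollapsible k.val x
    · obtain _ | n := n
      · exact absurd hc.1 (by omega)
      have hkn := hc.1
      obtain ⟨k, rfl⟩ : ∃ k' : Fin (n + 1), k'.castSucc = k := ⟨⟨k.val, by omega⟩, rfl⟩
      refine ⟨⟨n, (SSet.ex.{u}.obj X).δ k.succ x, k,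
        IsCollapsible.δ_mem_nonDegenerate hc hx hk, hk.δ_of_le _,
        IsCollapsible.not_isSaturated_δ hc hx, IsCollapsible.not_isCollapsible_δ hc hx⟩, Or.inl ?_⟩
      exact (SSet.S.ext_iff _ _).2 (isCollapsible_iff.1 hc).symm
    · exact ⟨⟨n, x, k, hx, hk, hk', hc⟩, Or.inr ((SSet.S.ext_iff _ _).2 (δ_extend hk).symm)⟩

instance (X : SSet.{u}) : (toExPairingCore X).IsProper where
  isUniquelyCodimOneFace s := by
    refine (SSet.S.IsUniquelyCodimOneFace.iff _ _).2 ⟨s.level.succ, rfl, fun i hi => ?_⟩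
    by_contra h
    exact extend_ne_σ s.isSaturated s.not_isSaturated s.not_isCollapsible i h
      (hi.trans (δ_extend s.isSaturated))

/-- The level is a weak rank function. -/
def toExWeakRankFunction (X : SSet.{u}) : (toExPairingCore X).WeakRankFunction ℕ where
  rank s := s.level.val
  lt {x y} hxy hdim := by
    obtain ⟨hne, hlt⟩ := hxy
    obtain ⟨f, hf, hf'⟩ := SSet.N.le_iff_exists_mono.1 (SSet.Subcomplex.N.le_iff.1 hlt.le)
    obtain ⟨n, v, k, hv, h₁, h₂, h₃⟩ := x
    obtain ⟨m, w, l, hw, h₄, h₅, h₆⟩ := y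
    obtain rfl : n = m := hdim
    replace hf : @Mono _ _ ⦋n⦌ ⦋n + 1⦌ f := hf
    obtain ⟨i, rfl⟩ := @SimplexCategory.eq_δ_of_mono n f hf
    replace hf' : (SSet.ex.{u}.obj X).δ i (extend l w) = v := hf'.trans (δ_extend h₁)
    change k.val < l.val
    by_contra hkl
    -- A face before `l + 1` has level below `l`; the face `l + 1` is `w` itself; a later face is
    -- `(l + 1)`-saturated and `l`-collapsible, so a type (II) simplex can occur there only with
    -- level below `l`.
    obtain hi | rfl | hi := lt_trichotomy i l.succ
    · have := (isSaturated_extend (k := l) (y := w)).δ_of_lt i (Nat.le_of_lt_succ hi)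
      rw [hf'] at this
      exact h₂ (this.mono (not_lt.1 hkl))
    · rw [δ_extend h₄] at hf'
      subst hf'
      exact hne (PairingIndex.ext_simplex rfl)
    · have h₇ := isCollapsible_δ_extend h₄ i (Nat.succ_le_of_lt hi)
      have h₈ := (isSaturated_extend (k := l) (y := w)).δ_of_le i
      rw [hf'] at h₇ h₈
      have h₉ : k.val = l.val := le_antisymm
        (not_lt.1 fun h => h₂ (h₈.mono h)) (not_lt.1 hkl)
      exact h₃ (h₉ ▸ h₇)

instance (X : SSet.{u}) : (toExPairingCore X).IsRegular :=
  (toExWeakRankFunction X).isRegular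

/-! ### Presentations of length `ω * ω` -/

section

open Ordinal

theorem exists_eq_omega0_mul_add {α : Ordinal.{u}} (h : α < ω * ω) :
    ∃ a b : ℕ, α = ω * (a : Ordinal.{u}) + b := by
  obtain ⟨q, hq, r, hr, rfl⟩ := lt_mul_iff.1 h
  obtain ⟨a, rfl⟩ := lt_omega0.1 hq
  obtain ⟨b, rfl⟩ := lt_omega0.1 hr
  exact ⟨a, b, rfl⟩

theorem omega0_mul_add_lt_omega0_mul {a b a' : ℕ} (h : a < a') :
    ω * (a : Ordinal.{u}) + b < ω * a' := by
  refine lt_of_lt_of_le (b := ω * ((a + 1 : ℕ) : Ordinal.{u})) ?_ ?_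
  · rw [Nat.cast_add, Nat.cast_one, mul_add_one]
    exact add_lt_add_right (natCast_lt_omega0 b) _
  · exact mul_le_mul_right (by exact_mod_cast h) _

theorem omega0_mul_add_lt_omega0_mul_omega0 (a b : ℕ) :
    ω * (a : Ordinal.{u}) + b < ω * ω :=
  lt_mul_iff.2 ⟨a, natCast_lt_omega0 a, b, natCast_lt_omega0 b, rfl⟩

variable {A B : SSet.{u}} {m : A ⟶ B}

/-- The union of the members `G a b` of a doubly indexed family of subcomplexes whose ordinal
position `ω * a + b` is at most `α`. -/
def doubleStage (G : ℕ → ℕ → B.Subcomplex) (α : Ordinal.{u}) : B.Subcomplex :=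
  ⨆ (p : ℕ × ℕ) (_ : ω * (p.1 : Ordinal.{u}) + p.2 ≤ α), G p.1 p.2

theorem le_doubleStage (G : ℕ → ℕ → B.Subcomplex) {a b : ℕ} {α : Ordinal.{u}}
    (h : ω * (a : Ordinal.{u}) + b ≤ α) : G a b ≤ doubleStage G α :=
  le_iSup₂_of_le (a, b) h le_rfl

theorem doubleStage_eq {G : ℕ → ℕ → B.Subcomplex} (h₁ : ∀ a b, G a b ≤ G a (b + 1))
    (h₂ : ∀ a, ⨆ b, G a b = G (a + 1) 0) (a b : ℕ) :
    doubleStage G (ω * (a : Ordinal.{u}) + b) = G a b := by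
  have hb : ∀ a, Monotone (G a) := fun a => monotone_nat_of_le_succ (h₁ a)
  have ha : Monotone (fun a => G a 0) := monotone_nat_of_le_succ
    (fun a => (le_iSup (G a) 0).trans (h₂ a).le)
  refine le_antisymm (iSup₂_le (fun ⟨a', b'⟩ h => ?_)) (le_doubleStage G le_rfl)
  dsimp only at h ⊢
  obtain hlt | rfl | hgt := lt_trichotomy a' a
  · exact (le_iSup (G a') b').trans ((h₂ a').le.trans ((ha hlt).trans (hb a (Nat.zero_le b))))
  · refine hb a' ?_
    exact_mod_cast (add_le_add_iff_left _).1 h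
  · exact absurd (h.trans_lt (omega0_mul_add_lt_omega0_mul hgt))
      (not_lt.2 (le_add_of_nonneg_right zero_le))

/-- An anodyne presentation of length `ω * ω`. -/
def AnodynePresentation.ofDoubleSequence (G : ℕ → ℕ → B.Subcomplex)
    (h₀ : G 0 0 = SSet.Subcomplex.range m) (h₁ : ∀ a b, G a b ≤ G a (b + 1))
    (h₂ : ∀ a, ⨆ b, G a b = G (a + 1) 0) (h₃ : ⨆ a, G a 0 = ⊤)
    (h₄ : ∀ a b, (MorphismProperty.coproducts.{u} SSet.modelCategoryQuillen.J.{u}).pushouts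
      (SSet.Subcomplex.homOfLE (h₁ a b))) : AnodynePresentation m where
  κ := ω * ω
  stage := doubleStage G
  mono α β h _ := iSup₂_le (fun p hp => le_doubleStage G (hp.trans h))
  stage_zero := by
    rw [← h₀]
    simpa using doubleStage_eq h₁ h₂ 0 0
  stage_top := by
    rw [eq_top_iff, ← h₃]
    exact iSup_le (fun a => le_doubleStage G (omega0_mul_add_lt_omega0_mul_omega0 a 0).le)
  iSup_lt_top := by
    rw [eq_top_iff, ← h₃]
    exact iSup_le (fun a => le_iSup_of_le ⟨_, omega0_mul_add_lt_omega0_mul_omega0 a 0⟩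
      (le_doubleStage G le_rfl))
  iSup_lt_limit l hl hlim := by
    refine le_antisymm (iSup_le (fun α => iSup₂_le
      (fun p hp => le_doubleStage G (hp.trans (le_of_lt α.2))))) ?_
    obtain ⟨a, b, rfl⟩ := exists_eq_omega0_mul_add hl
    rw [doubleStage_eq h₁ h₂]
    -- The limit ordinals below `ω * ω` are the `ω * (a + 1)`, where `h₂` applies; zero and
    -- successors contradict `hlim`.
    obtain _ | b := b
    · obtain _ | a := a
      · simp at hlim
      · rw [← h₂]
        refine iSup_le (fun b => le_iSup_of_le ⟨ω * (a : Ordinal.{u}) + b, ?_⟩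
          (le_doubleStage G le_rfl))
        exact (omega0_mul_add_lt_omega0_mul (Nat.lt_succ_self a)).trans_le
          (le_add_of_nonneg_right zero_le)
    · refine absurd hlim ?_
      rw [Nat.cast_add, Nat.cast_one, ← add_assoc, ← Order.succ_eq_add_one]
      exact Order.not_isSuccLimit_succ _
  attach α h := by
    obtain ⟨a, b, rfl⟩ := exists_eq_omega0_mul_add h
    have e₁ := doubleStage_eq h₁ h₂ a b
    have e₂ : doubleStage G (Order.succ (ω * (a : Ordinal.{u}) + b)) = G a (b + 1) := by
      rw [← doubleStage_eq h₁ h₂, Order.succ_eq_add_one, Nat.cast_add, Nat.cast_one, add_assoc]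
    have key : ∀ (S T : B.Subcomplex) (hST : S ≤ T), S = G a b → T = G a (b + 1) →
        (MorphismProperty.coproducts.{u} SSet.modelCategoryQuillen.J.{u}).pushouts
          (SSet.Subcomplex.homOfLE hST) := by
      rintro _ _ _ rfl rfl
      exact h₄ a b
    exact key _ _ _ e₁ e₂

end

/-! ### Strong anodyne extensions and sequential colimits -/

section

variable {Y Z : SSet.{u}}

/-- A monomorphism maps each subcomplex isomorphically onto its image, so the two inclusions are
isomorphic arrows. -/
theorem pushouts_homOfLE_image (P : MorphismProperty SSet.{u}) [P.RespectsIso] (f : Y ⟶ Z) [Mono f]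
    {S T : Y.Subcomplex} (h : S ≤ T) (h' : S.image f ≤ T.image f)
    (hP : P (SSet.Subcomplex.homOfLE h)) : P (SSet.Subcomplex.homOfLE h') := by
  have hiso : ∀ U : Y.Subcomplex, IsIso (U.toImage f) := fun U => by
    have : Mono (U.toImage f) := mono_of_mono_fac (U.toImage_ι f)
    exact isIso_of_mono_of_epi _
  exact (P.arrow_mk_iso_iff (Arrow.isoMk (@asIso _ _ _ _ (S.toImage f) (hiso S))
    (@asIso _ _ _ _ (T.toImage f) (hiso T)) rfl)).1 hP

theorem pushouts_homOfLE_filtration {S : Y.Subcomplex} {P : S.Pairing} [P.IsProper]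
    (f : P.RankFunction ℕ) (b : ℕ) :
    (MorphismProperty.coproducts.{u} SSet.modelCategoryQuillen.J.{u}).pushouts
      (SSet.Subcomplex.homOfLE (f.filtration_monotone (Nat.le_succ b))) := by
  refine MorphismProperty.pushouts_monotone (MorphismProperty.coproducts_monotone ?_) _
    (f.relativeCellComplex.attachCells b (not_isMax b)).pushouts_coproducts
  rintro _ _ _ ⟨c⟩
  exact SSet.modelCategoryQuillen.horn_ι_mem_J _ _

variable (F : ℕ ⥤ SSet.{u})

theorem mono_map_of_succ (hF : ∀ n, Mono (F.map (homOfLE (Nat.le_add_right n 1)))) {i j : ℕ}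
    (f : i ⟶ j) : Mono (F.map f) := by
  obtain ⟨k, rfl⟩ := Nat.exists_eq_add_of_le (leOfHom f)
  obtain rfl := Subsingleton.elim f (homOfLE (Nat.le_add_right i k))
  induction k with
  | zero => exact inferInstanceAs (Mono (F.map (𝟙 i)))
  | succ k hk =>
    have := hk
    have := hF (i + k)
    rw [← homOfLE_comp (Nat.le_add_right i k) (Nat.le_add_right (i + k) 1), F.map_comp]
    infer_instance

theorem mono_colimit_ι (hF : ∀ n, Mono (F.map (homOfLE (Nat.le_add_right n 1)))) (n : ℕ) :
    Mono (colimit.ι F n) := by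
  rw [NatTrans.mono_iff_mono_app]
  intro k
  rw [mono_iff_injective]
  intro x y hxy
  have hc := isColimitOfPreserves ((evaluation _ _).obj k) (colimit.isColimit F)
  obtain ⟨j, f, h⟩ := (Types.FilteredColimit.isColimit_eq_iff' hc x y).1 hxy
  have := mono_map_of_succ F hF f
  exact (mono_iff_injective _).1 ((NatTrans.mono_iff_mono_app _).1 this k) h

/-- The `a`-th transition map contributes `ω` steps, leading from the image of stage `a` to that of
stage `a + 1`; together they form a presentation of length `ω * ω`. -/
theorem isStrongAnodyne_colimit_ι
    (hF : ∀ n, SSet.strongAnodyneExtensions (F.map (homOfLE (Nat.le_add_right n 1)))) :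
    IsStrongAnodyne (colimit.ι F 0) := by
  have hm := mono_colimit_ι F (fun n => (hF n).mono)
  choose hF' P hP using hF
  let G (a b : ℕ) : (colimit F).Subcomplex :=
    ((P a).rankFunction.filtration b).image (colimit.ι F (a + 1))
  have hG (a : ℕ) : G a 0 = SSet.Subcomplex.range (colimit.ι F a) := by
    dsimp only [G]
    rw [← Nat.bot_eq_zero, SSet.Subcomplex.Pairing.RankFunction.filtration_bot,
      ← SSet.Subcomplex.range_comp, colimit.w]
  have h₁ (a b : ℕ) : G a b ≤ G a (b + 1) :=
    SSet.Subcomplex.image_monotone _ ((P a).rankFunction.filtration_monotone (Nat.le_succ b))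
  refine ⟨hm 0, ⟨.ofDoubleSequence G (hG 0) h₁ (fun a => ?_) ?_ (fun a b => ?_)⟩⟩
  · rw [hG, ← SSet.Subcomplex.image_iSup, SSet.Subcomplex.Pairing.RankFunction.iSup_filtration,
      SSet.Subcomplex.image_top]
  · simp only [hG]
    exact SSet.iSup_range_eq_top_of_isColimit (colimit.isColimit F)
  · exact pushouts_homOfLE_image _ _ _ _ (pushouts_homOfLE_filtration _ b)

theorem anodyneExtensions_colimit_ι
    (hF : ∀ n, SSet.anodyneExtensions (F.map (homOfLE (Nat.le_add_right n 1)))) :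
    SSet.anodyneExtensions (colimit.ι F 0) := by
  refine MorphismProperty.transfiniteCompositionsOfShape_le SSet.anodyneExtensions ℕ _
    ⟨{ F := F
       isoBot := Iso.refl _
       incl := (colimit.cocone F).ι
       isColimit := colimit.isColimit F
       map_mem := fun n _ => hF n }⟩

end

theorem strongAnodyneExtensions_toEx (X : SSet.{u}) :
    SSet.strongAnodyneExtensions (toEx.app X) :=
  ⟨inferInstance, (toExPairingCore X).pairing, inferInstance⟩

theorem exSequence_map_succ (X : SSet.{u}) (n : ℕ) :
    (exSequence.obj X).map (homOfLE (Nat.le_add_right n 1)) = toEx.app ((exIter n).obj X) :=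
  congrArg (fun f : exIter.{u} n ⟶ exIter (n + 1) => f.app X)
    (Functor.ofSequence_map_homOfLE_succ exIterSucc.{u} n)

theorem isStrongAnodyne_toExInfty (X : SSet.{u}) : IsStrongAnodyne (toExInfty X) := by
  refine isStrongAnodyne_colimit_ι (exSequence.obj X) (fun n => ?_)
  rw [exSequence_map_succ]
  exact strongAnodyneExtensions_toEx _

theorem anodyneExtensions_toExInfty (X : SSet.{u}) : SSet.anodyneExtensions (toExInfty X) := by
  refine anodyneExtensions_colimit_ι (exSequence.obj X) (fun n => ?_)
  rw [exSequence_map_succ]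
  exact SSet.strongAnodyneExtensions_le_anodyneExtensions _ (strongAnodyneExtensions_toEx _)

/-! ### Filling horns in `Ex` after one further subdivision -/

namespace Faces

theorem image_eq_self {n : ℕ} (α : Fin (n + 1) →o Fin (n + 1)) (S : Faces.{u} n)
    (h : ∀ i ∈ S.finset, α i.down = i.down) : image α S = S := by
  ext i
  rw [image, mem_ofRel]
  constructor
  · rintro ⟨j, hj, hji⟩
    obtain rfl : j = i := ULift.ext _ _ ((h j hj).symm.trans hji)
    exact hj
  · exact fun hi => ⟨i, hi, h i hi⟩

theorem mem_image {m n : ℕ} (α : Fin (m + 1) →o Fin (n + 1)) (S : Faces.{u} m)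
    (i : ULift.{u} (Fin (n + 1))) :
    i ∈ (image α S).finset ↔ ∃ j ∈ S.finset, α j.down = i.down :=
  mem_ofRel _ _ _ _

/-- The elements of `S` which are bounded above by `i`. -/
def below {n : ℕ} (S : Faces.{u} n) (i : Fin (n + 1)) : Finset (ULift.{u} (Fin (n + 1))) :=
  S.finset.filter (fun j => j.down ≤ i)

open scoped Classical in
/-- The monotone retraction onto `S` which sends `i` to the greatest element of `S` below `i`, or
to the least element of `S` if there is no such element. -/
def retraction {n : ℕ} (S : Faces.{u} n) : Fin (n + 1) →o Fin (n + 1) where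
  toFun i := if h : (S.below i).Nonempty then ((S.below i).max' h).down
    else (S.finset.min' S.nonempty).down
  monotone' i i' hi := by
    have hsub : S.below i ⊆ S.below i' := fun j hj => by
      rw [below, Finset.mem_filter] at hj ⊢
      exact ⟨hj.1, hj.2.trans hi⟩
    by_cases h : (S.below i).Nonempty
    · simp only [dif_pos h, dif_pos (h.mono hsub)]
      exact Finset.max'_subset h hsub
    · simp only [dif_neg h]
      split_ifs with h'
      · exact Finset.min'_le S.finset ((S.below i').max' h')
          (Finset.mem_filter.1 (Finset.max'_mem (S.below i') h')).1
      · exact le_rfl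

theorem retraction_mem {n : ℕ} (S : Faces.{u} n) (i : Fin (n + 1)) :
    ULift.up (S.retraction i) ∈ S.finset := by
  classical
  change ULift.up (dite _ _ _) ∈ _
  split_ifs with h
  · exact (Finset.mem_filter.1 (Finset.max'_mem _ h)).1
  · exact Finset.min'_mem S.finset S.nonempty

theorem retraction_of_mem {n : ℕ} (S : Faces.{u} n) (i : Fin (n + 1))
    (hi : ULift.up i ∈ S.finset) : S.retraction i = i := by
  classical
  have hi' : ULift.up i ∈ S.below i := Finset.mem_filter.2 ⟨hi, le_rfl⟩
  change dite _ _ _ = _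
  rw [dif_pos ⟨_, hi'⟩]
  exact le_antisymm (Finset.mem_filter.1 (Finset.max'_mem _ ⟨_, hi'⟩)).2
    (Finset.le_max' (S.below i) ⟨i⟩ hi')

theorem lastVertexHom_image {m n : ℕ} (α : Fin (m + 1) →o Fin (n + 1)) (S : Faces.{u} m) :
    lastVertexHom n (image α S) = α (lastVertexHom m S) := by
  rw [← map_eq_image (α.uliftMap) α (fun _ => rfl)]
  exact lastVertexHom_map _ _

end Faces

theorem chain_ext {n m : ℕ} {s t : (SimplexCategory.sd.{u}.obj ⦋n⦌) _⦋m⦌}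
    (h : ∀ i : Fin (m + 1), s.obj i = t.obj i) : s = t :=
  CategoryTheory.Functor.ext h (fun _ _ _ => Subsingleton.elim _ _)

/-- The monotone map of a chain. -/
def chainHom {n m : ℕ} (s : (SimplexCategory.sd.{u}.obj ⦋n⦌) _⦋m⦌) :
    Fin (m + 1) →o Faces.{u} n where
  toFun i := s.obj i
  monotone' _ _ h := (s.map (homOfLE h)).le

section

variable {Y : SSet.{u}} {n : ℕ} {k : Fin (n + 2)}

/-- A subset of `{0, ..., n + 1}` spans a simplex of the `k`-th horn. -/
def IsHornFace (k : Fin (n + 2)) (S : Faces.{u} (n + 1)) : Prop :=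
  ∃ j, j ≠ k ∧ ULift.up j ∉ S.finset

/-- A monotone map into `{0, ..., n + 1}` is a simplex of the `k`-th horn. -/
def IsHornSimplex (k : Fin (n + 2)) {l : ℕ} (α : Fin (l + 1) →o Fin (n + 2)) : Prop :=
  ∃ j, j ≠ k ∧ ∀ i, α i ≠ j

theorem IsHornSimplex.comp {l m : ℕ} {α : Fin (l + 1) →o Fin (n + 2)} (h : IsHornSimplex k α)
    (β : Fin (m + 1) →o Fin (l + 1)) : IsHornSimplex k (α.comp β) := by
  obtain ⟨j, hj, hj'⟩ := h
  exact ⟨j, hj, fun i => hj' _⟩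

theorem IsHornSimplex.isHornFace {l : ℕ} {α : Fin (l + 1) →o Fin (n + 2)} (h : IsHornSimplex k α)
    (S : Faces.{u} l) : IsHornFace k (image α S) := by
  obtain ⟨j, hj, hj'⟩ := h
  refine ⟨j, hj, fun h => ?_⟩
  obtain ⟨i, -, hi⟩ := (mem_image _ _ _).1 h
  exact hj' _ hi

theorem IsHornFace.isHornSimplex {S : Faces.{u} (n + 1)} (h : IsHornFace k S) :
    IsHornSimplex k S.retraction := by
  obtain ⟨j, hj, hj'⟩ := h
  exact ⟨j, hj, fun i hi => hj' (hi ▸ S.retraction_mem i)⟩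

/-- The simplex of the horn given by a monotone map. -/
def hornSimplex {l : ℕ} (α : Fin (l + 1) →o Fin (n + 2)) (h : IsHornSimplex k α) :
    (Λ[n + 1, k] : SSet.{u}) _⦋l⦌ :=
  ⟨SSet.stdSimplex.objMk α, by
    obtain ⟨j, hj, hj'⟩ := h
    rw [SSet.mem_horn_iff_notMem_range]
    exact ⟨j, hj, fun ⟨i, hi⟩ => hj' i hi⟩⟩

theorem exists_eq_hornSimplex {l : ℕ} (z : (Λ[n + 1, k] : SSet.{u}) _⦋l⦌) :
    ∃ (α : Fin (l + 1) →o Fin (n + 2)) (h : IsHornSimplex k α), z = hornSimplex α h := by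
  obtain ⟨z, hz⟩ := z
  obtain ⟨j, hj, hj'⟩ := (SSet.mem_horn_iff_notMem_range _ _).1 hz
  exact ⟨(SSet.stdSimplex.objEquiv z).toOrderHom, ⟨j, hj, fun i hi => hj' ⟨i, hi⟩⟩,
    Subtype.ext (SSet.stdSimplex.objEquiv.injective rfl)⟩

variable (f : (Λ[n + 1, k] : SSet.{u}) ⟶ SSet.ex.obj Y)

/-- The value of a map from a horn to `Ex Y` at a simplex. -/
def hornValue {l : ℕ} (α : Fin (l + 1) →o Fin (n + 2)) (h : IsHornSimplex k α) :
    (SSet.ex.obj Y) _⦋l⦌ :=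
  f.app (op ⦋l⦌) (hornSimplex α h)

theorem hornValue_comp {l m : ℕ} (α : Fin (l + 1) →o Fin (n + 2)) (h : IsHornSimplex k α)
    (β : Fin (m + 1) →o Fin (l + 1)) :
    hornValue f (α.comp β) (h.comp β) = pull (image β) (hornValue f α h) := by
  have := (ConcreteCategory.congr_hom
    (f.naturality (SimplexCategory.mkHom β).op) (hornSimplex α h))
  refine Eq.trans ?_ (this.trans (ex_map _ _))
  rfl

/-- A map from a horn to `Ex Y` evaluated at a chain of subsets which span simplices of the horn. -/
def chainValue {m : ℕ} (t : (SimplexCategory.sd.{u}.obj ⦋n + 1⦌) _⦋m⦌)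
    (h : IsHornFace k (t.obj (Fin.last m))) : Y _⦋m⦌ :=
  (hornValue f (retraction (t.obj (Fin.last m))) h.isHornSimplex).down.app (op ⦋m⦌) t

/-- A map from the horn to `Ex Y` amounts to a map from the subdivided horn to `Y`: its value on a
chain does not depend on the horn simplex used to compute it. Retractions serve as standard choices
because they exist in the fixed dimension `n + 1`, without numbering the elements of each subset. -/
theorem hornValue_app {l m : ℕ} (α : Fin (l + 1) →o Fin (n + 2)) (h : IsHornSimplex k α)
    (t : (SimplexCategory.sd.{u}.obj ⦋l⦌) _⦋m⦌) :
    (hornValue f α h).down.app (op ⦋m⦌) t =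
      chainValue f ((sdMap (image α)).app (op ⦋m⦌) t) (h.isHornFace _) := by
  -- Composing with `ρ` does not affect the chain `t`, and it confines `α` to the image of the
  -- largest member of `t`, where the standard retraction is the identity.
  let ρ := retraction (t.obj (Fin.last m))
  have hρ : (sdMap (image ρ)).app (op ⦋m⦌) t = t := chain_ext (fun i =>
    image_eq_self _ _ (fun j hj => retraction_of_mem _ _
      ((t.map (homOfLE (Fin.le_last i))).le hj)))
  have hα : (retraction (image α (t.obj (Fin.last m)))).comp (α.comp ρ) = α.comp ρ := by
    ext i : 2
    exact retraction_of_mem _ _ ((mem_image _ _ _).2 ⟨_, retraction_mem _ i, rfl⟩)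
  have h₁ : (hornValue f (α.comp ρ) (h.comp ρ)).down.app (op ⦋m⦌) t =
      (hornValue f α h).down.app (op ⦋m⦌) t := by
    rw [hornValue_comp]
    exact congrArg ((hornValue f α h).down.app (op ⦋m⦌)) hρ
  have h₂ : (hornValue f (α.comp ρ) (h.comp ρ)).down.app (op ⦋m⦌) t =
      chainValue f ((sdMap (image α)).app (op ⦋m⦌) t) (h.isHornFace _) := by
    have := hornValue_comp f _ (h.isHornFace (t.obj (Fin.last m))).isHornSimplex (α.comp ρ)
    simp only [hα] at this
    rw [this, ← image_comp]
    exact congrArg (fun s => (hornValue f _ _).down.app (op ⦋m⦌)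
      ((sdMap (image α)).app (op ⦋m⦌) s)) hρ
  exact h₁.symm.trans h₂

theorem chainValue_congr {m : ℕ} {t t' : (SimplexCategory.sd.{u}.obj ⦋n + 1⦌) _⦋m⦌} (e : t = t')
    (h : IsHornFace k (t.obj (Fin.last m))) :
    chainValue f t h = chainValue f t' (e ▸ h) := by
  subst e
  rfl

/-- The restricted chain may end in a smaller subset and so use another retraction; `hornValue_app`
shows that both give the same value. -/
theorem chainValue_map {m m' : ℕ} (t : (SimplexCategory.sd.{u}.obj ⦋n + 1⦌) _⦋m⦌)
    (h : IsHornFace k (t.obj (Fin.last m))) (β : ⦋m'⦌ ⟶ ⦋m⦌)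
    (h' : IsHornFace k (((SimplexCategory.sd.{u}.obj ⦋n + 1⦌).map β.op t).obj (Fin.last m'))) :
    Y.map β.op (chainValue f t h) =
      chainValue f ((SimplexCategory.sd.{u}.obj ⦋n + 1⦌).map β.op t) h' := by
  have h₁ := ConcreteCategory.congr_hom
    ((hornValue f (retraction (t.obj (Fin.last m))) h.isHornSimplex).down.naturality β.op) t
  refine h₁.symm.trans ((hornValue_app f _ _ _).trans (chainValue_congr f (chain_ext
    (fun i => image_eq_self _ _ (fun j hj => retraction_of_mem _ _ ?_))) _))
  exact (t.map (homOfLE (Fin.le_last (β.toOrderHom i)))).le hj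

open scoped Classical in
/-- The last vertex of a subset which spans a simplex of the `k`-th horn; the vertex `k` for other
subsets. -/
def hornVertex (k : Fin (n + 2)) (S : Faces.{u} (n + 1)) : Fin (n + 2) :=
  if IsHornFace k S then lastVertexHom (n + 1) S else k

/-- The map of posets of subsets induced by the values of `hornVertex` on a chain. -/
def hornVertexMap (k : Fin (n + 2)) {m : ℕ} (s : Fin (m + 1) → Faces.{u} (n + 1)) :
    Faces.{u} m →o Faces.{u} (n + 1) :=
  ofRel (fun j i => hornVertex k (s j) = i) (fun _ => ⟨_, rfl⟩)

theorem hornVertexMap_comp {m m' : ℕ} (s : Fin (m + 1) → Faces.{u} (n + 1))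
    (β : Fin (m' + 1) →o Fin (m + 1)) :
    hornVertexMap k (s ∘ β) = (hornVertexMap k s).comp (image β) := by
  rw [hornVertexMap, hornVertexMap, Faces.image, ofRel_comp]
  refine ofRel_congr (fun a b => ?_)
  simp only [Relation.Comp, exists_eq_left', Function.comp_apply]

/-- On subsets spanning horn simplices only last vertices enter, so the filler restricts on the horn
to `f` followed by `toEx`. -/
theorem hornVertexMap_image {l m : ℕ} {α : Fin (l + 1) →o Fin (n + 2)} (hα : IsHornSimplex k α)
    (s : Fin (m + 1) →o Faces.{u} l) :
    hornVertexMap k (image α ∘ s) = image (α.comp ((lastVertexHom l).comp s)) := by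
  refine ofRel_congr (fun a b => ?_)
  rw [Function.comp_apply, hornVertex, if_pos (hα.isHornFace _), lastVertexHom_image]
  rfl

/-- Along a chain, the largest member spanning a horn simplex misses some `j ≠ k`, as do all smaller
members; the other members contribute `k`. Thus `j` is never a value. Since `hornVertex` need not be
monotone along a chain, it gives sets of vertices rather than simplices of the horn, which is why
one further subdivision is used. -/
theorem isHornFace_hornVertexMap {m : ℕ} (s : Fin (m + 1) →o Faces.{u} (n + 1)) (T : Faces.{u} m) :
    IsHornFace k (hornVertexMap k s T) := by
  classical
  suffices ∃ j, j ≠ k ∧ ∀ i, IsHornFace k (s i) → ULift.up j ∉ (s i).finset by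
    obtain ⟨j, hj, h⟩ := this
    refine ⟨j, hj, fun hj' => ?_⟩
    obtain ⟨i, -, hi⟩ := (mem_ofRel _ _ _ _).1 hj'
    rw [hornVertex] at hi
    split_ifs at hi with hi'
    · refine h _ hi' ?_
      rw [← show _ = j from hi]
      exact Finset.max'_mem _ (s i.down).nonempty
    · exact hj hi.symm
  by_cases h : ∃ i, IsHornFace k (s i)
  · obtain ⟨i, hi, hi'⟩ := Finset.exists_max_image
      (Finset.univ.filter (fun i => IsHornFace k (s i)))
      id (by obtain ⟨i, hi⟩ := h; exact ⟨i, by simpa using hi⟩)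
    simp only [Finset.mem_filter, Finset.mem_univ, true_and, id_eq] at hi hi'
    obtain ⟨j, hj, hj'⟩ := hi
    exact ⟨j, hj, fun i' h' hi'' => hj' (s.monotone (hi' i' h') hi'')⟩
  · obtain ⟨j, hj⟩ := exists_ne k
    exact ⟨j, hj, fun i hi => (h ⟨i, hi⟩).elim⟩

/-- The simplex of `Y` which is given by a chain of subsets of `{0, ..., n + 1}` and a chain of
sets of its indices. -/
def hornFillerValue {m l : ℕ} (s : Fin (m + 1) →o Faces.{u} (n + 1))
    (t : (SimplexCategory.sd.{u}.obj ⦋m⦌) _⦋l⦌) : Y _⦋l⦌ :=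
  chainValue f ((sdMap (hornVertexMap k s)).app (op ⦋l⦌) t) (isHornFace_hornVertexMap s _)

/-- The `m`-simplex of `Ex Y` which is given by a chain of subsets of `{0, ..., n + 1}`. -/
def hornFillerSimplex {m : ℕ} (s : Fin (m + 1) →o Faces.{u} (n + 1)) :
    SimplexCategory.sd.{u}.obj ⦋m⦌ ⟶ Y where
  app l := ↾fun t => hornFillerValue f (l := l.unop.len) s t
  naturality := by
    rintro ⟨⟨l⟩⟩ ⟨⟨l'⟩⟩ ⟨β⟩
    ext t
    exact (chainValue_map f ((sdMap (hornVertexMap k s)).app (op ⦋l⦌) t)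
      (isHornFace_hornVertexMap s _) β (isHornFace_hornVertexMap s _)).symm

/-- The map `sd Δ[n + 1] ⟶ Ex Y` which extends a map from a horn to `Ex Y` up to subdivision. -/
def hornFiller : SimplexCategory.sd.{u}.obj ⦋n + 1⦌ ⟶ SSet.ex.obj Y where
  app m := ↾fun s => ULift.up (hornFillerSimplex f (m := m.unop.len) (chainHom s))
  naturality m m' β := by
    ext s
    refine ULift.ext _ _ ?_
    change _ = SimplexCategory.sd.{u}.map (X := m'.unop) (Y := m.unop) β.unop ≫
      hornFillerSimplex f (m := m.unop.len) (chainHom s)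
    rw [sd_map (m := m'.unop.len) (n := m.unop.len) β.unop]
    ext ⟨⟨l⟩⟩ t
    refine chainValue_congr f (m := l) (chain_ext (fun i => ?_))
      (isHornFace_hornVertexMap _ _)
    exact congrArg (fun g : Faces.{u} _ →o Faces.{u} _ => g (t.obj i))
      (hornVertexMap_comp (chainHom (m := m.unop.len) s) β.unop.toOrderHom)

theorem exists_extension_of_horn :
    ∃ g : Δ[n + 1] ⟶ SSet.ex.obj (SSet.ex.obj Y),
      Λ[n + 1, k].ι ≫ g = f ≫ toEx.app (SSet.ex.obj Y) := by
  refine ⟨SSet.yonedaEquiv.symm (ULift.up (hornFiller f)), ?_⟩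
  ext ⟨⟨l⟩⟩ z
  obtain ⟨α, hα, rfl⟩ := exists_eq_hornSimplex z
  refine ULift.ext _ _ ?_
  change SimplexCategory.sd.{u}.map (SimplexCategory.mkHom α) ≫
    hornFiller f = lastVertex.app ⦋l⦌ ≫ SSet.yonedaEquiv.symm (hornValue f α hα)
  rw [sd_map]
  ext ⟨⟨m⟩⟩ x
  -- `β` lists the last vertices of the chain `x`; both sides evaluate `f` on the horn simplex `α ∘
  -- β`.
  let β : Fin (m + 1) →o Fin (l + 1) := (lastVertexHom l).comp (chainHom x)
  change ULift.up (hornFillerSimplex f ((image α).comp (chainHom x))) =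
    (SSet.ex.obj Y).map (SimplexCategory.mkHom β).op (hornValue f α hα)
  rw [ex_map, ← hornValue_comp]
  refine ULift.ext _ _ ?_
  ext ⟨⟨p⟩⟩ t
  refine Eq.trans ?_ (hornValue_app f _ (hα.comp β) t).symm
  refine chainValue_congr f (chain_ext (fun i => ?_))
    (isHornFace_hornVertexMap _ _)
  exact congrArg (fun g : Faces.{u} _ →o Faces.{u} _ => g (t.obj i))
    (hornVertexMap_image hα (chainHom x))

end

/-! ### `Ex^∞ X` is a Kan complex -/

section

open HomotopicalAlgebra SSet.modelCategoryQuillen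

theorem kanComplex_of_exists_extension {Z : SSet.{u}}
    (h : ∀ (n : ℕ) (k : Fin (n + 2)) (f : (Λ[n + 1, k] : SSet.{u}) ⟶ Z),
      ∃ g : Δ[n + 1] ⟶ Z, Λ[n + 1, k].ι ≫ g = f) : SSet.KanComplex Z := by
  refine (isFibrant_iff _).2 ⟨?_⟩
  rw [fibrations_eq]
  intro _ _ _ hf
  simp only [J, MorphismProperty.iSup_iff] at hf
  obtain ⟨n, ⟨i⟩⟩ := hf
  refine ⟨fun {t _} _ ↦ ?_⟩
  obtain ⟨φ, hφ⟩ := h _ _ t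
  exact ⟨⟨{
    l := φ
    fac_left := hφ
    fac_right := by subsingleton }⟩⟩

theorem kanComplex_exInfty (X : SSet.{u}) : SSet.KanComplex (exInfty.obj X) := by
  refine kanComplex_of_exists_extension (fun n k f => ?_)
  have := Cardinal.fact_isRegular_aleph0.{u}
  have : IsCardinalFiltered ℕ Cardinal.aleph0.{u} := by
    rw [isCardinalFiltered_aleph0_iff]
    infer_instance
  obtain ⟨m, f', rfl⟩ := IsCardinalPresentable.exists_hom_of_isColimit Cardinal.aleph0.{u}
    (colimit.isColimit (exSequence.obj X)) f
  -- By presentability of the horn, `f` factors through stage `m`. One application of `toEx` puts it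
  -- into `Ex` of something, as the filling requires, and a second is used by the filling, so `g`
  -- lands in stage `m + 2`.
  obtain ⟨g, hg⟩ := exists_extension_of_horn (Y := (exIter m).obj X)
    (f' ≫ toEx.app ((exIter m).obj X))
  refine ⟨g ≫ colimit.ι (exSequence.obj X) (m + 1 + 1), ?_⟩
  have h (i : ℕ) : toEx.app ((exIter i).obj X) ≫ colimit.ι (exSequence.obj X) (i + 1) =
      colimit.ι (exSequence.obj X) i := by
    rw [← exSequence_map_succ]
    exact colimit.w _ _
  refine (congrArg (fun φ => φ ≫ colimit.ι (exSequence.obj X) (m + 1 + 1)) hg).trans ?_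
  refine (congrArg (fun φ => f' ≫ toEx.app ((exIter m).obj X) ≫ φ) (h (m + 1))).trans ?_
  exact congrArg (fun φ => f' ≫ φ) (h m)

end

/-! ### Maps which agree on the source of an anodyne extension are homotopic -/

section

variable {A B K : SSet.{u}} {f g : B ⟶ K}

open scoped Classical in
/-- Two maps which agree on a subcomplex `S` define a map on the union of `B × ∂Δ[1]` and
`S × Δ[1]`. -/
def unionProdDesc (S : B.Subcomplex) (h : S.ι ≫ f = S.ι ≫ g) :
    (S.unionProd ∂Δ[1] : SSet.{u}) ⟶ K where
  app k := ↾fun x => if SSet.stdSimplex.asOrderHom x.1.2 (Fin.last _) = 0 then f.app k x.1.1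
    else g.app k x.1.1
  naturality := by
    rintro ⟨⟨p⟩⟩ ⟨⟨q⟩⟩ ⟨β⟩
    ext ⟨⟨b, t⟩, hx⟩
    change ite (t (β.toOrderHom (Fin.last q)) = 0) (f.app _ (B.map _ b)) (g.app _ (B.map _ b)) =
      K.map _ (ite (t (Fin.last p) = 0) (f.app _ b) (g.app _ b))
    have hf := ConcreteCategory.congr_hom (f.naturality (Quiver.Hom.op β)) b
    have hg := ConcreteCategory.congr_hom (g.naturality (Quiver.Hom.op β)) b
    by_cases h₀ : t (Fin.last p) = 0
    · have h₁ : t (β.toOrderHom (Fin.last q)) = 0 := by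
        refine le_antisymm ?_ (Fin.zero_le _)
        rw [← h₀]
        exact SSet.stdSimplex.monotone_apply t (Fin.le_last _)
      rw [if_pos h₀, if_pos h₁]
      exact hf
    · rw [if_neg h₀]
      split_ifs with h₁
      -- Here `t` ends at `1` but its restriction ends at `0`, so `t` hits both vertices, is not in
      -- the boundary, and forces `b` into `S`, where `f` and `g` agree.
      · have hb : b ∈ S.obj _ := by
          refine ((SSet.Subcomplex.mem_unionProd_iff _ _ _).1 hx).resolve_left (fun ht => ?_)
          obtain ⟨j, hj⟩ := (SSet.mem_boundary_iff_notMem_range _).1 ht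
          refine hj ?_
          obtain rfl | rfl : j = 0 ∨ j = 1 := by lia
          · exact ⟨_, h₁⟩
          · exact ⟨_, Fin.eq_one_of_ne_zero _ h₀⟩
        exact hf.trans (congrArg (K.map _)
          (ConcreteCategory.congr_hom (congrArg (fun φ => φ.app (op ⦋p⦌)) h) ⟨b, hb⟩))
      · exact hg

theorem unionProdDesc_app_of_eq_zero (S : B.Subcomplex) (h : S.ι ≫ f = S.ι ≫ g) {p : ℕ}
    (x : (S.unionProd ∂Δ[1] : SSet.{u}) _⦋p⦌)
    (hx : SSet.stdSimplex.asOrderHom x.1.2 (Fin.last _) = 0) :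
    (unionProdDesc S h).app (op ⦋p⦌) x = f.app (op ⦋p⦌) x.1.1 :=
  if_pos hx

theorem unionProdDesc_app_of_ne_zero (S : B.Subcomplex) (h : S.ι ≫ f = S.ι ≫ g) {p : ℕ}
    (x : (S.unionProd ∂Δ[1] : SSet.{u}) _⦋p⦌)
    (hx : SSet.stdSimplex.asOrderHom x.1.2 (Fin.last _) ≠ 0) :
    (unionProdDesc S h).app (op ⦋p⦌) x = g.app (op ⦋p⦌) x.1.1 :=
  if_neg hx

open HomotopicalAlgebra SSet.modelCategoryQuillen in
theorem exists_extension_of_anodyneExtensions [SSet.KanComplex K] {m : A ⟶ B}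
    (hm : SSet.anodyneExtensions m) (f : A ⟶ K) : ∃ g : B ⟶ K, m ≫ g = f := by
  have := hm _ (mem_fibrations (terminal.from K))
  have sq : CommSq f m (terminal.from K) (terminal.from B) := ⟨by subsingleton⟩
  exact ⟨sq.lift, sq.fac_left⟩

/-- The inclusion of `B × ∂Δ[1] ∪ S × Δ[1]` into `B × Δ[1]` is anodyne because `S.ι` is, so the map
given by `f` and `g` on the ends and constant along `S` extends. -/
theorem exists_homotopy_of_subcomplex [SSet.KanComplex K] (S : B.Subcomplex)
    (hS : SSet.anodyneExtensions S.ι) (h : S.ι ≫ f = S.ι ≫ g) : Nonempty (SSet.Homotopy f g) := by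
  obtain ⟨H, hH⟩ := exists_extension_of_anodyneExtensions
    (SSet.anodyneExtensions_unionProd_ι' S ∂Δ[1] hS) (unionProdDesc S h)
  exact ⟨{
    h := H
    h₀ := by
      ext ⟨⟨p⟩⟩ b
      have hb : SSet.ι₀.app _ b ∈ (S.unionProd ∂Δ[1]).obj (op ⦋p⦌) :=
        (SSet.Subcomplex.mem_unionProd_iff _ _ _).2 (Or.inl
          ((SSet.mem_boundary_iff_notMem_range _).2 ⟨1, by rintro ⟨j, hj⟩; exact zero_ne_one hj⟩))
      exact (ConcreteCategory.congr_hom (congrArg (fun φ => φ.app (op ⦋p⦌)) hH) ⟨_, hb⟩).trans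
        (unionProdDesc_app_of_eq_zero S h ⟨_, hb⟩ rfl)
    h₁ := by
      ext ⟨⟨p⟩⟩ b
      have hb : SSet.ι₁.app _ b ∈ (S.unionProd ∂Δ[1]).obj (op ⦋p⦌) :=
        (SSet.Subcomplex.mem_unionProd_iff _ _ _).2 (Or.inl
          ((SSet.mem_boundary_iff_notMem_range _).2 ⟨0, by rintro ⟨j, hj⟩; exact one_ne_zero hj⟩))
      exact (ConcreteCategory.congr_hom (congrArg (fun φ => φ.app (op ⦋p⦌)) hH) ⟨_, hb⟩).trans
        (unionProdDesc_app_of_ne_zero S h ⟨_, hb⟩ one_ne_zero)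
    rel := by
      ext k ⟨⟨b, hb⟩, t⟩
      exact hb.elim }⟩

theorem exists_homotopy_of_anodyneExtensions [SSet.KanComplex K] {m : A ⟶ B} [Mono m]
    (hm : SSet.anodyneExtensions m) (h : m ≫ f = m ≫ g) : Nonempty (SSet.Homotopy f g) := by
  have hiso : IsIso (SSet.Subcomplex.toRange m) := inferInstance
  refine exists_homotopy_of_subcomplex (SSet.Subcomplex.range m) ?_ ?_
  · exact (SSet.anodyneExtensions.arrow_mk_iso_iff (f := m) (g := (SSet.Subcomplex.range m).ι)
      (Arrow.isoMk (@asIso _ _ _ _ (SSet.Subcomplex.toRange m) hiso) (Iso.refl _) rfl)).1 hm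
  · rw [← cancel_epi (SSet.Subcomplex.toRange m), SSet.Subcomplex.toRange_ι_assoc,
      SSet.Subcomplex.toRange_ι_assoc, h]

end

/-! ### The map `X ⟶ Ex^∞ X` is a weak homotopy equivalence -/

theorem toExInfty_naturality {X Y : SSet.{u}} (f : X ⟶ Y) :
    toExInfty X ≫ exInfty.map f = f ≫ toExInfty Y :=
  ι_colimMap (exSequence.map f) 0

/-- Write `j` and `J` for the canonical maps out of `X` and `Ex^∞ X`. Naturality gives `j ≫ Ex^∞ j =
j ≫ J`. For a retraction `r` of `J`, the composite `Ex^∞ j ≫ r` agrees with the identity after `j`,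
and `r ≫ Ex^∞ j` does so after `j ≫ J`; both of these maps are anodyne. -/
theorem isWeakHomotopyEquiv_toExInfty (X : SSet.{u}) : IsWeakHomotopyEquiv (toExInfty X) := by
  have := kanComplex_exInfty X
  have := kanComplex_exInfty (exInfty.obj X)
  have h₁ := anodyneExtensions_toExInfty X
  have h₂ := anodyneExtensions_toExInfty (exInfty.obj X)
  have : Mono (toExInfty X) := (isStrongAnodyne_toExInfty X).1
  have : Mono (toExInfty (exInfty.obj X)) := (isStrongAnodyne_toExInfty _).1
  have h := toExInfty_naturality (toExInfty X)
  obtain ⟨r, hr⟩ := exists_extension_of_anodyneExtensions h₂ (𝟙 _)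
  refine ⟨r, exists_homotopy_of_anodyneExtensions h₁ ?_,
    exists_homotopy_of_anodyneExtensions (MorphismProperty.comp_mem _ _ _ h₁ h₂) ?_⟩
  · rw [reassoc_of% h, hr]
  · rw [Category.assoc, reassoc_of% hr, h, Category.comp_id]

end ExInfinity

end

theorem mainTheorem2 (X : SSet.{u}) :
    ExInfinity.IsStrongAnodyne (ExInfinity.toExInfty X) ∧
      ExInfinity.IsWeakHomotopyEquiv (ExInfinity.toExInfty X) :=
  ⟨ExInfinity.isStrongAnodyne_toExInfty X, ExInfinity.isWeakHomotopyEquiv_toExInfty X⟩
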